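/- **Setting.** Let $M$ be a connected, paracompact, Hausdorff smooth finite-dimensional manifold, $\Lambda\colon M\to(0,+\infty)$ a smooth function and $F\colon TM\to[0,+\infty)$ a (not necessarily reversible) Finsler metric: $F$ is continuous on $TM$, smooth and positive on $TM\setminus 0$, fiberwise positively homogeneous of degree $1$, and for each $v\in T_xM\setminus\{0\}$ the vertical Hessian $g_v=\frac12\frac{\partial^2F^2}{\partial v^i\partial v^j}(v)$ is positive definite. The associated standard static Finsler spacetime is $\tilde M=\mathbb R\times M$ with the Finsler function $L(\tau,v)=-\Lambda\tau^2+F^2(v)$, $(\tau,v)\in T_{(t,x)}\tilde M=\mathbb R\times T_xM$. Let $\mathcal T$ be the line bundle spanned by $\partial_t$ and, for $w\in T\tilde M\setminus\mathcal T$, let $\tilde g_w=\frac12\frac{\partial^2L}{\partial v^i\partial v^j}(w)$ be the vertical Hessian of $L$ at $w$. A vector $w$ is *timelike* if $w\in\mathcal T\setminus 0$ or ($w\notin\mathcal T$ and $\tilde g_w(w,w)<0$), *lightlike* if $w\notin\mathcal T$ and $\tilde g_w(w,w)=0$, *causal* if it is timelike or lightlike. A causal vector $w$ is *future-pointing* if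 it is a positive multiple of $\partial_t$, or $w\notin\mathcal T$ and $\tilde g_w(w,\partial_t)<0$. Curves $\gamma\colon[a,b]\to\tilde M$ ($a<b$) are continuous and piecewise smooth (smooth on each closed interval of some subdivision); a curve is timelike, lightlike, causal, or future-pointing if all its one-sided derivatives are. A *proper variation* of $\gamma$ is a continuous map $\psi\colon(-\varepsilon,\varepsilon)\times[a,b]\to\tilde M$, $\varepsilon>0$, with $\psi(0,\cdot)=\gamma$, $\psi(w,a)=\gamma(a)$ and $\psi(w,b)=\gamma(b)$ for all $w$, which is smooth on each $(-\varepsilon,\varepsilon)\times[s_{j-1},s_j]$ for some subdivision $a=s_0<\dots<s_k=b$. A *geodesic* is a curve $\gamma\colon[a,b]\to\tilde M$ that is a critical point of the energy $E(\gamma)=\frac12\int_a^bL(\dot\gamma)\,ds$, i.e. $\frac{d}{dr}E(\psi(r,\cdot))|_{r=0}=0$ for all proper variations $\psi$ of $\gamma$. A curve $\gamma\colon[c,d]\to\tilde M$ is a *pregeodesic* if $\gamma\circ\varphi$ is a geodesic for some continuous, piecewise $C^1$ map $\varphi\colon[a,b]\to[c,d]$ ($a<b$) with $\varphi(a)=c$,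 $\varphi(b)=d$ and positive one-sided derivatives; a *lightlike pregeodesic* is a pregeodesic which is a lightlike curve. Write $p\ll q$ if there is a future-pointing timelike curve from $p$ to $q$, and $p\le q$ if $p=q$ or there is a future-pointing causal curve from $p$ to $q$. Put $I^+(p)=\{q: p\ll q\}$, $I^-(p)=\{q: q\ll p\}$, $J^+(p)=\{q: p\le q\}$, $J^-(p)=\{q: q\le p\}$. **Statement.** 1. Let $\rho\colon[a,b]\to\tilde M$ be a future-pointing causal curve that is not a lightlike pregeodesic. Then there is a proper variation $\psi\colon(-\varepsilon,\varepsilon)\times[a,b]\to\tilde M$ of $\rho$ such that for every $w\in(-\varepsilon,\varepsilon)$, $w\neq0$, the curve $\psi(w,\cdot)$ is timelike and future-pointing. 2. For all $p,q,z\in\tilde M$: if $p\le q$ and $q\ll z$, or if $p\ll q$ and $q\le z$, then $p\ll z$. 3. For all $p\in\tilde M$: $\overline{J^+(p)}=\overline{I^+(p)}$ and $\overline{J^-(p)}=\overline{I^-(p)}$. -/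

import Mathlib

open Set MeasureTheory
open scoped Manifold ContDiff Topology

noncomputable section

namespace StaticFinsler

/-- Half of the second derivative of `Q : V → ℝ` at `v` in the directions `u`, `w`:
`(1/2) ∂²/∂r∂s Q (v + r u + s w)` at `r = s = 0`. For a function on a tangent space this is the
(value of the) vertical Hessian, `(1/2) ∂²Q/∂vⁱ∂vʲ (v) uⁱ wʲ`, used only where `Q` is smooth. -/
def vertHessian {V : Type*} [AddCommGroup V] [Module ℝ V] (Q : V → ℝ) (v u w : V) : ℝ :=
  (1 / 2) * deriv (fun r : ℝ => deriv (fun s : ℝ => Q (v + r • u + s • w)) 0) 0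

/-- A (not necessarily reversible) Finsler metric on the manifold `M` modelled on `E`. -/
structure FinslerMetric (E : Type*) [NormedAddCommGroup E] [NormedSpace ℝ E]
    (M : Type*) [TopologicalSpace M] [ChartedSpace E M] [IsManifold 𝓘(ℝ, E) ∞ M] where
  /-- the value `F(v)` for `v ∈ T_x M` -/
  toFun : (x : M) → TangentSpace 𝓘(ℝ, E) x → ℝ
  continuous_toFun :
    Continuous (fun v : TangentBundle 𝓘(ℝ, E) M => toFun v.proj v.snd)
  smooth_off_zero :
    ContMDiffOn 𝓘(ℝ, E).tangent 𝓘(ℝ, ℝ) ∞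
      (fun v : TangentBundle 𝓘(ℝ, E) M => toFun v.proj v.snd) {v | v.snd ≠ 0}
  pos : ∀ (x : M) (v : TangentSpace 𝓘(ℝ, E) x), v ≠ 0 → 0 < toFun x v
  homogeneous : ∀ (x : M) (v : TangentSpace 𝓘(ℝ, E) x) (c : ℝ), 0 ≤ c →
    toFun x (c • v) = c * toFun x v
  /-- the fundamental tensor `g_v`, the vertical Hessian of `F²`, is positive definite -/
  posDef : ∀ (x : M) (v w : TangentSpace 𝓘(ℝ, E) x), v ≠ 0 → w ≠ 0 →
    0 < vertHessian (fun u : TangentSpace 𝓘(ℝ, E) x => toFun x u ^ 2) v w w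

/-- The data of a standard static Finsler spacetime `ℝ × M`: a Finsler metric `F` on `M` and a
smooth positive function `Λ` on `M`. -/
structure Spacetime (E : Type*) [NormedAddCommGroup E] [NormedSpace ℝ E]
    (M : Type*) [TopologicalSpace M] [ChartedSpace E M] [IsManifold 𝓘(ℝ, E) ∞ M] where
  F : FinslerMetric E M
  lapse : M → ℝ
  lapse_pos : ∀ x, 0 < lapse x
  lapse_smooth : ContMDiff 𝓘(ℝ, E) 𝓘(ℝ, ℝ) ∞ lapse

/-- `a = t 0 < t 1 < ⋯ < t k = b` is a subdivision of `[a, b]`. -/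
structure IsSubdivision (a b : ℝ) (k : ℕ) (t : ℕ → ℝ) : Prop where
  first : t 0 = a
  last : t k = b
  lt : ∀ j < k, t j < t (j + 1)

section Curves

variable {E : Type*} [NormedAddCommGroup E] [NormedSpace ℝ E]
  {M : Type*} [TopologicalSpace M] [ChartedSpace E M]

variable (E) in
/-- The restriction of `γ` to `[a, b]` is a continuous piecewise smooth curve in `ℝ × M`. -/
def IsCurve (γ : ℝ → ℝ × M) (a b : ℝ) : Prop :=
  ContinuousOn γ (Icc a b) ∧
  ∃ (k : ℕ) (t : ℕ → ℝ), IsSubdivision a b k t ∧ ∀ j < k,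
    ContMDiffOn 𝓘(ℝ, ℝ) (𝓘(ℝ, ℝ).prod 𝓘(ℝ, E)) ∞ γ (Icc (t j) (t (j + 1)))

variable (E) in
/-- The tangent space of `ℝ × M` at `p = (t, x)`, that is `ℝ × T_x M`. -/
abbrev Tan (p : ℝ × M) : Type _ := ℝ × TangentSpace 𝓘(ℝ, E) p.2

variable (E) in
/-- The derivative of the curve `γ = (θ, σ)` at `s` within the set `A`. -/
def velocityWithin (γ : ℝ → ℝ × M) (A : Set ℝ) (s : ℝ) : Tan E (γ s) :=
  (derivWithin (fun r => (γ r).1) A s,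
    mfderivWithin 𝓘(ℝ, ℝ) 𝓘(ℝ, E) (fun r => (γ r).2) A s (1 : ℝ))

variable (E) in
/-- Right derivative. -/
def velocityRight (γ : ℝ → ℝ × M) (s : ℝ) : Tan E (γ s) := velocityWithin E γ (Ici s) s

variable (E) in
/-- Left derivative. -/
def velocityLeft (γ : ℝ → ℝ × M) (s : ℝ) : Tan E (γ s) := velocityWithin E γ (Iic s) s

variable (E) in
/-- All one-sided derivatives of the curve `γ : [a, b] → ℝ × M` have the property `P`. -/
def VelocitiesSatisfy (P : (p : ℝ × M) → Tan E p → Prop) (γ : ℝ → ℝ × M) (a b : ℝ) : Prop :=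
  (∀ s ∈ Ico a b, P (γ s) (velocityRight E γ s)) ∧
  (∀ s ∈ Ioc a b, P (γ s) (velocityLeft E γ s))

variable (E) in
/-- `ψ`, defined on `(-ε, ε) × [a, b]`, is a proper variation of `γ : [a, b] → ℝ × M`. -/
structure IsProperVariation (γ : ℝ → ℝ × M) (a b ε : ℝ) (ψ : ℝ → ℝ → ℝ × M) : Prop where
  eps_pos : 0 < ε
  continuousOn :
    ContinuousOn (fun z : ℝ × ℝ => ψ z.1 z.2) (Ioo (-ε) ε ×ˢ Icc a b)
  base : ∀ s ∈ Icc a b, ψ 0 s = γ s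
  isCurve : ∀ w ∈ Ioo (-ε) ε, IsCurve E (ψ w) a b
  left_end : ∀ w ∈ Ioo (-ε) ε, ψ w a = γ a
  right_end : ∀ w ∈ Ioo (-ε) ε, ψ w b = γ b
  smooth : ∃ (k : ℕ) (t : ℕ → ℝ), IsSubdivision a b k t ∧ ∀ j < k,
    ContMDiffOn 𝓘(ℝ, ℝ × ℝ) (𝓘(ℝ, ℝ).prod 𝓘(ℝ, E)) ∞
      (fun z : ℝ × ℝ => ψ z.1 z.2) (Ioo (-ε) ε ×ˢ Icc (t j) (t (j + 1)))

/-- `φ : [a, b] → [c, d]` is an orientation preserving reparametrization: a continuous, piecewise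
`C¹` map onto `[c, d]` with positive one-sided derivatives. -/
structure IsReparametrization (φ : ℝ → ℝ) (a b c d : ℝ) : Prop where
  continuousOn : ContinuousOn φ (Icc a b)
  left_end : φ a = c
  right_end : φ b = d
  regular : ∃ (k : ℕ) (t : ℕ → ℝ), IsSubdivision a b k t ∧ ∀ j < k,
    ContDiffOn ℝ 1 φ (Icc (t j) (t (j + 1))) ∧
    ∀ s ∈ Icc (t j) (t (j + 1)), 0 < derivWithin φ (Icc (t j) (t (j + 1))) s

end Curves

namespace Spacetime

variable {E : Type*} [NormedAddCommGroup E] [NormedSpace ℝ E]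
  {M : Type*} [TopologicalSpace M] [ChartedSpace E M] [IsManifold 𝓘(ℝ, E) ∞ M]
  (S : Spacetime E M)

/-- The Finsler function `L(τ, v) = -Λ τ² + F²(v)`. -/
def L (p : ℝ × M) (v : Tan E p) : ℝ :=
  -S.lapse p.2 * v.1 ^ 2 + S.F.toFun p.2 v.2 ^ 2

/-- The tensor `g̃_v(u, w)`, the vertical Hessian of `L`; meaningful for `v ∉ 𝒯`. -/
def gTilde (p : ℝ × M) (v u w : Tan E p) : ℝ := vertHessian (S.L p) v u w

/-- The vector field `∂_t`. -/
def dt (p : ℝ × M) : Tan E p := (1, 0)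

/-- The line bundle `𝒯` spanned by `∂_t`. -/
def InT (p : ℝ × M) (v : Tan E p) : Prop := ∃ c : ℝ, v = c • dt p

def Timelike (p : ℝ × M) (v : Tan E p) : Prop :=
  (InT p v ∧ v ≠ 0) ∨ (¬ InT p v ∧ S.gTilde p v v v < 0)

def Lightlike (p : ℝ × M) (v : Tan E p) : Prop :=
  ¬ InT p v ∧ S.gTilde p v v v = 0

/-- Timelike or lightlike; in particular the nonzero vectors of `𝒯` are causal. -/
def Causal (p : ℝ × M) (v : Tan E p) : Prop :=
  S.Timelike p v ∨ S.Lightlike p v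

def FuturePointing (p : ℝ × M) (v : Tan E p) : Prop :=
  (∃ c : ℝ, 0 < c ∧ v = c • dt p) ∨ (¬ InT p v ∧ S.gTilde p v v (dt p) < 0)

/-- `γ : [a, b] → ℝ × M` is a timelike curve. -/
def IsTimelikeCurve (γ : ℝ → ℝ × M) (a b : ℝ) : Prop :=
  IsCurve E γ a b ∧ VelocitiesSatisfy E S.Timelike γ a b

def IsLightlikeCurve (γ : ℝ → ℝ × M) (a b : ℝ) : Prop :=
  IsCurve E γ a b ∧ VelocitiesSatisfy E S.Lightlike γ a b

def IsCausalCurve (γ : ℝ → ℝ × M) (a b : ℝ) : Prop :=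
  IsCurve E γ a b ∧ VelocitiesSatisfy E S.Causal γ a b

/-- All one-sided derivatives of `γ : [a, b] → ℝ × M` are future-pointing. -/
def IsFuturePointing (γ : ℝ → ℝ × M) (a b : ℝ) : Prop :=
  VelocitiesSatisfy E S.FuturePointing γ a b

/-- The energy `(1/2) ∫ L(γ̇) ds` over `[a, b]` (the right derivative is the derivative off the
finitely many breaks). -/
def energy (γ : ℝ → ℝ × M) (a b : ℝ) : ℝ :=
  (1 / 2) * ∫ s in a..b, S.L (γ s) (velocityRight E γ s)

/-- Geodesics: critical points of the energy for proper variations. -/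
def IsGeodesic (γ : ℝ → ℝ × M) (a b : ℝ) : Prop :=
  IsCurve E γ a b ∧ ∀ (ε : ℝ) (ψ : ℝ → ℝ → ℝ × M), IsProperVariation E γ a b ε ψ →
    HasDerivAt (fun r => S.energy (ψ r) a b) 0 0

/-- `γ : [c, d] → ℝ × M` becomes a geodesic after an orientation preserving
reparametrization. -/
def IsPregeodesic (γ : ℝ → ℝ × M) (c d : ℝ) : Prop :=
  ∃ (a b : ℝ) (φ : ℝ → ℝ), a < b ∧ IsReparametrization φ a b c d ∧ S.IsGeodesic (γ ∘ φ) a b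

def IsLightlikePregeodesic (γ : ℝ → ℝ × M) (c d : ℝ) : Prop :=
  S.IsLightlikeCurve γ c d ∧ S.IsPregeodesic γ c d

/-- `p ≪ q`: there is a future-pointing timelike curve from `p` to `q`. -/
def Chron (p q : ℝ × M) : Prop :=
  ∃ (a b : ℝ) (γ : ℝ → ℝ × M), a < b ∧ S.IsTimelikeCurve γ a b ∧ S.IsFuturePointing γ a b ∧
    γ a = p ∧ γ b = q

/-- `p ≤ q`: `p = q` or there is a future-pointing causal curve from `p` to `q`. -/
def CausalRel (p q : ℝ × M) : Prop :=
  p = q ∨ ∃ (a b : ℝ) (γ : ℝ → ℝ × M), a < b ∧ S.IsCausalCurve γ a b ∧ S.IsFuturePointing γ a b ∧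
    γ a = p ∧ γ b = q

def chronFuture (p : ℝ × M) : Set (ℝ × M) := {q | S.Chron p q}

def chronPast (p : ℝ × M) : Set (ℝ × M) := {q | S.Chron q p}

def causalFuture (p : ℝ × M) : Set (ℝ × M) := {q | S.CausalRel p q}

def causalPast (p : ℝ × M) : Set (ℝ × M) := {q | S.CausalRel q p}

end Spacetime

end StaticFinsler

end

open StaticFinsler

/-! A vector `(τ, v)` is future-pointing exactly when `τ > 0`, and timelike exactly when `L < 0`:
Euler's relation turns `g̃_w(w, w)` into `L(w)`, and `g̃_w(w, ∂_t) = -Λτ`. Since `Λ` and `F` do not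
depend on `t`, adding `r h(s)` to the time component of a curve changes `L` only through `-Λ(τ + r
h')²`. All the variations arise by choosing such an `h`, vanishing at both ends.

If some velocity of the causal curve has `L < 0`, then by continuity a whole subinterval `[c, d]` is
timelike. Take `h' = 1` off `[c, d]`, which makes causal vectors timelike for every `r > 0`, and let
`h` have the compensating negative slope on `[c, d]`, where small changes keep the velocities
timelike (`hasTimelikeVariation_of_timelike_piece`).

Otherwise the curve is lightlike throughout. Reparametrize it so that `Λτ = 1`. If it is not a
pregeodesic, the reparametrized curve is not critical for the energy. Its spatial velocities do not
vanish, so `L` is smooth near them, the energy of every proper variation is differentiable at `r =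
0`, and some variation has nonzero derivative. Reversing `r` if necessary, the pointwise derivative
`k(s) = ∂_r L` has negative integral. Let `κ < 0` be its mean and `h' = (k - κ)/2`. Then `h`
vanishes at both ends, and after the time shift the derivative of `L` is `k - 2Λτh' = κ` at every
`s`. As `L = 0` at `r = 0`, all velocities are timelike for small `r > 0`
(`hasTimelikeVariation_of_integral_neg`). In both cases `r = w²` covers both signs of `w`.

For the push-up property, a causal curve joined to a timelike one contains a timelike piece, so the
first case applies. The closure statements follow: moving `q ∈ J⁺(p)` slightly up along `∂_t` lands
in `I⁺(p)`, and dually for the past. -/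

namespace StaticFinsler

/-! ### Properties holding piecewise on a subdivision. -/

/-- `P` holds on the consecutive intervals of some subdivision of `[a, b]`. -/
def PiecewiseOn (P : ℝ → ℝ → Prop) (a b : ℝ) : Prop :=
  ∃ (k : ℕ) (t : ℕ → ℝ), IsSubdivision a b k t ∧ ∀ j < k, P (t j) (t (j + 1))

/-- `P` passes to nondegenerate subintervals. -/
def Hereditary (P : ℝ → ℝ → Prop) : Prop :=
  ∀ ⦃c d c' d' : ℝ⦄, P c d → c ≤ c' → c' < d' → d' ≤ d → P c' d'

theorem IsSubdivision.mono {a b : ℝ} {k : ℕ} {t : ℕ → ℝ} (h : IsSubdivision a b k t)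
    {i j : ℕ} (hij : i ≤ j) (hj : j ≤ k) : t i ≤ t j := by
  induction j, hij using Nat.le_induction with
  | base => exact le_rfl
  | succ n hn ih => exact (ih (by omega)).trans (h.lt n (by omega)).le

namespace PiecewiseOn

variable {P Q R : ℝ → ℝ → Prop} {a b c d : ℝ}

theorem refl (P : ℝ → ℝ → Prop) (a : ℝ) : PiecewiseOn P a a :=
  ⟨0, fun _ => a, ⟨rfl, rfl, by simp⟩, by simp⟩

theorem le (h : PiecewiseOn P a b) : a ≤ b := by
  obtain ⟨k, t, ht, -⟩ := h
  simpa [ht.first, ht.last] using ht.mono (Nat.zero_le k) le_rfl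

theorem snoc (h : PiecewiseOn P a c) (hcd : c < d) (hP : P c d) : PiecewiseOn P a d := by
  obtain ⟨k, t, ht, hPt⟩ := h
  refine ⟨k + 1, fun n => if n ≤ k then t n else d, ⟨by simp [ht.first], by simp, ?_⟩, ?_⟩
  · intro j hj
    rcases (Nat.lt_succ_iff.1 hj).lt_or_eq with h1 | h1
    · simpa [h1.le, h1] using ht.lt j h1
    · subst h1; simpa [ht.last] using hcd
  · intro j hj
    rcases (Nat.lt_succ_iff.1 hj).lt_or_eq with h1 | h1
    · simpa [h1.le, h1] using hPt j h1
    · subst h1; simpa [ht.last] using hP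

theorem single (hab : a < b) (h : P a b) : PiecewiseOn P a b := (refl P a).snoc hab h

/-- The gluing principle: continuity, integrability, strict monotonicity and the like pass from the
pieces to `[a, b]` because they survive appending one more interval. -/
theorem induct (h : PiecewiseOn P a b) (hab : a < b)
    (h1 : ∀ c d, a ≤ c → c < d → d ≤ b → P c d → Q c d)
    (h2 : ∀ c d, a < c → c < d → d ≤ b → Q a c → Q c d → Q a d) : Q a b := by
  obtain ⟨k, t, ht, hPt⟩ := h
  have hk : 0 < k := by
    rcases Nat.eq_zero_or_pos k with h0 | h0
    · subst h0; exact absurd (ht.first.symm.trans ht.last) hab.ne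
    · exact h0
  have hQ : ∀ j < k, Q (t j) (t (j + 1)) := fun j hj =>
    h1 _ _ (by simpa [ht.first] using ht.mono (Nat.zero_le j) hj.le) (ht.lt j hj)
      (by simpa [ht.last] using ht.mono hj le_rfl) (hPt j hj)
  have main : ∀ j, j < k → Q a (t (j + 1)) := by
    intro j
    induction j with
    | zero => intro h0; simpa [ht.first] using hQ 0 h0
    | succ n ih =>
      intro hn
      refine h2 _ _ ?_ (ht.lt _ hn) (by simpa [ht.last] using ht.mono hn le_rfl)
        (ih (by omega)) (hQ _ hn)
      have e1 := ht.lt 0 hk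
      rw [ht.first] at e1
      exact e1.trans_le (ht.mono (by omega) (by omega))
  have := main (k - 1) (by omega)
  rwa [Nat.sub_add_cancel hk, ht.last] at this

theorem mono (h : PiecewiseOn P a b)
    (h1 : ∀ c d, a ≤ c → c < d → d ≤ b → P c d → Q c d) : PiecewiseOn Q a b := by
  obtain ⟨k, t, ht, hPt⟩ := h
  exact ⟨k, t, ht, fun j hj =>
    h1 _ _ (by simpa [ht.first] using ht.mono (Nat.zero_le j) hj.le) (ht.lt j hj)
      (by simpa [ht.last] using ht.mono hj le_rfl) (hPt j hj)⟩

theorem trans (h : PiecewiseOn P a b) (h' : PiecewiseOn P b c) : PiecewiseOn P a c := by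
  rcases h'.le.eq_or_lt with e | e
  · rwa [← e]
  refine h'.induct (Q := fun x y => PiecewiseOn P a x → PiecewiseOn P a y) e ?_ ?_ h
  · exact fun x y _ hxy _ hP hx => hx.snoc hxy hP
  · exact fun x y _ _ _ h1 h2 h3 => h2 (h1 h3)

theorem right (h : PiecewiseOn P a b) {s : ℝ} (hs : s ∈ Ico a b) :
    ∃ c d, a ≤ c ∧ d ≤ b ∧ s ∈ Ico c d ∧ P c d := by
  refine h.induct (Q := fun x y => ∀ s ∈ Ico x y, ∃ c d, a ≤ c ∧ d ≤ b ∧ s ∈ Ico c d ∧ P c d)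
    (hs.1.trans_lt hs.2) ?_ ?_ s hs
  · exact fun c d hc _ hd hP s hs => ⟨c, d, hc, hd, hs, hP⟩
  · intro c d _ _ _ h1 h2 s hs
    rcases lt_or_ge s c with h3 | h3
    · exact h1 s ⟨hs.1, h3⟩
    · exact h2 s ⟨h3, hs.2⟩

theorem left (h : PiecewiseOn P a b) {s : ℝ} (hs : s ∈ Ioc a b) :
    ∃ c d, a ≤ c ∧ d ≤ b ∧ s ∈ Ioc c d ∧ P c d := by
  refine h.induct (Q := fun x y => ∀ s ∈ Ioc x y, ∃ c d, a ≤ c ∧ d ≤ b ∧ s ∈ Ioc c d ∧ P c d)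
    (hs.1.trans_le hs.2) ?_ ?_ s hs
  · exact fun c d hc _ hd hP s hs => ⟨c, d, hc, hd, hs, hP⟩
  · intro c d _ _ _ h1 h2 s hs
    rcases le_or_gt s c with h3 | h3
    · exact h1 s ⟨hs.1, h3⟩
    · exact h2 s ⟨h3, hs.2⟩

/-- The supremum of the points reachable by a subdivision is itself reachable, by the left
condition, and cannot lie below `b`, by the right one. Common refinements and restrictions then need
only a check near each point. -/
theorem of_local (hP : Hereditary P) (hab : a ≤ b)
    (hr : ∀ s ∈ Ico a b, ∃ e ∈ Ioc s b, P s e) (hl : ∀ s ∈ Ioc a b, ∃ e ∈ Ico a s, P e s) :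
    PiecewiseOn P a b := by
  set A : Set ℝ := {x | x ∈ Icc a b ∧ PiecewiseOn P a x} with hA
  have haA : a ∈ A := ⟨⟨le_rfl, hab⟩, refl P a⟩
  have hbdd : BddAbove A := ⟨b, fun x hx => hx.1.2⟩
  have hac : a ≤ sSup A := le_csSup hbdd haA
  have hcb : sSup A ≤ b := csSup_le ⟨a, haA⟩ fun x hx => hx.1.2
  have hc : PiecewiseOn P a (sSup A) := by
    rcases hac.eq_or_lt with h0 | h0
    · rw [← h0]; exact refl P a
    obtain ⟨e, he, hPe⟩ := hl _ ⟨h0, hcb⟩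
    obtain ⟨x, hx, hex⟩ := exists_lt_of_lt_csSup ⟨a, haA⟩ he.2
    rcases (le_csSup hbdd hx).eq_or_lt with h1 | h1
    · rw [← h1]; exact hx.2
    · exact hx.2.snoc h1 (hP hPe hex.le h1 le_rfl)
  rcases hcb.eq_or_lt with h0 | h0
  · rwa [h0] at hc
  obtain ⟨e, he, hPe⟩ := hr _ ⟨hac, h0⟩
  exact absurd (le_csSup hbdd (show e ∈ A from ⟨⟨hac.trans he.1.le, he.2⟩, hc.snoc he.1 hPe⟩))
    (not_le.2 he.1)

theorem and (hP : Hereditary P) (hQ : Hereditary Q) (h : PiecewiseOn P a b)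
    (h' : PiecewiseOn Q a b) : PiecewiseOn (fun c d => P c d ∧ Q c d) a b := by
  refine of_local (fun c d c' d' h h1 h2 h3 => ⟨hP h.1 h1 h2 h3, hQ h.2 h1 h2 h3⟩) h.le ?_ ?_
  · intro s hs
    obtain ⟨c, d, -, hd, hs1, h1⟩ := h.right hs
    obtain ⟨c', d', -, hd', hs2, h2⟩ := h'.right hs
    have : s < min d d' := lt_min hs1.2 hs2.2
    exact ⟨min d d', ⟨this, (min_le_left _ _).trans hd⟩, hP h1 hs1.1 this (min_le_left _ _),
      hQ h2 hs2.1 this (min_le_right _ _)⟩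
  · intro s hs
    obtain ⟨c, d, hc, -, hs1, h1⟩ := h.left hs
    obtain ⟨c', d', hc', -, hs2, h2⟩ := h'.left hs
    have : max c c' < s := max_lt hs1.1 hs2.1
    exact ⟨max c c', ⟨hc.trans (le_max_left _ _), this⟩, hP h1 (le_max_left _ _) this hs1.2,
      hQ h2 (le_max_right _ _) this hs2.2⟩

theorem restrict (hP : Hereditary P) (h : PiecewiseOn P a b) (hac : a ≤ c) (hcd : c ≤ d)
    (hdb : d ≤ b) : PiecewiseOn P c d := by
  refine of_local hP hcd ?_ ?_
  · intro s hs
    obtain ⟨x, y, -, -, hs1, h1⟩ := h.right ⟨hac.trans hs.1, hs.2.trans_le hdb⟩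
    have : s < min y d := lt_min hs1.2 hs.2
    exact ⟨min y d, ⟨this, min_le_right _ _⟩, hP h1 hs1.1 this (min_le_left _ _)⟩
  · intro s hs
    obtain ⟨x, y, -, -, hs1, h1⟩ := h.left ⟨hac.trans_lt hs.1, hs.2.trans hdb⟩
    have : max x c < s := max_lt hs1.1 hs.1
    exact ⟨max x c, ⟨le_max_right _ _, this⟩, hP h1 (le_max_left _ _) this hs1.2⟩

/-- Pulling back along an increasing bijection `u : [a, b] → [u a, u b]`. -/
theorem comp {u : ℝ → ℝ} (hab : a ≤ b) (hu : ContinuousOn u (Icc a b))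
    (hmono : StrictMonoOn u (Icc a b)) (h : PiecewiseOn P (u a) (u b)) :
    PiecewiseOn (fun c d => P (u c) (u d)) a b := by
  have pre : ∀ y ∈ Icc (u a) (u b), ∃ x ∈ Icc a b, u x = y := fun y hy =>
    intermediate_value_Icc hab hu hy
  have ha : a ∈ Icc a b := ⟨le_rfl, hab⟩
  have hb : b ∈ Icc a b := ⟨hab, le_rfl⟩
  obtain ⟨k, t, ht, hPt⟩ := h
  have hmem : ∀ j ≤ k, t j ∈ Icc (u a) (u b) := fun j hj =>
    ⟨by simpa [ht.first] using ht.mono (Nat.zero_le j) hj,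
      by simpa [ht.last] using ht.mono hj le_rfl⟩
  choose! g hg using fun j hj => pre (t j) (hmem j hj)
  refine ⟨k, g, ⟨?_, ?_, ?_⟩, ?_⟩
  · exact hmono.injOn (hg 0 (Nat.zero_le k)).1 ha ((hg 0 (Nat.zero_le k)).2.trans ht.first)
  · exact hmono.injOn (hg k le_rfl).1 hb ((hg k le_rfl).2.trans ht.last)
  · intro j hj
    rw [← hmono.lt_iff_lt (hg j hj.le).1 (hg (j + 1) hj).1, (hg j hj.le).2, (hg (j + 1) hj).2]
    exact ht.lt j hj
  · intro j hj
    rw [(hg j hj.le).2, (hg (j + 1) hj).2]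
    exact hPt j hj

end PiecewiseOn

/-! ### Primitives and inverse functions on closed intervals. -/

/-- Agreement is asked only on `[c, d)` because the integrands are built from right derivatives,
which at `d` belong to the next piece; one point does not affect the integral. -/
theorem contDiffOn_integral_piece {g g' : ℝ → ℝ} {a c d : ℝ} (hcd : c < d)
    (hint : IntervalIntegrable g volume a c) (hg' : ContDiffOn ℝ ∞ g' (Icc c d))
    (heq : EqOn g g' (Ico c d)) :
    IntervalIntegrable g volume c d ∧
    ContDiffOn ℝ ∞ (fun s => ∫ x in a..s, g x) (Icc c d) ∧
    ∀ s ∈ Icc c d, HasDerivWithinAt (fun s => ∫ x in a..s, g x) (g' s) (Icc c d) s := by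
  have hae : ∀ s ∈ Icc c d, ∀ᵐ x ∂volume, x ∈ uIoc c s → g' x = g x := by
    intro s hs
    filter_upwards [Measure.ae_ne volume d] with x hx hxs
    rw [uIoc_of_le hs.1] at hxs
    exact (heq ⟨hxs.1.le, (hxs.2.trans hs.2).lt_of_ne hx⟩).symm
  have hi' : ∀ s ∈ Icc c d, IntervalIntegrable g' volume c s := fun s hs =>
    (hg'.continuousOn.mono (Icc_subset_Icc le_rfl hs.2)).intervalIntegrable_of_Icc hs.1
  have hi : ∀ s ∈ Icc c d, IntervalIntegrable g volume c s := fun s hs =>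
    (hi' s hs).congr_ae ((ae_restrict_iff' measurableSet_uIoc).2 (hae s hs))
  have hH : ∀ s ∈ Icc c d, (∫ x in a..s, g x) = (∫ x in a..c, g x) + ∫ x in c..s, g' x := by
    intro s hs
    rw [← intervalIntegral.integral_add_adjacent_intervals hint (hi s hs),
      intervalIntegral.integral_congr_ae (hae s hs)]
  have hder : ∀ s ∈ Icc c d,
      HasDerivWithinAt (fun s => ∫ x in a..s, g x) (g' s) (Icc c d) s := by
    intro s hs
    have : Fact (s ∈ Icc c d) := ⟨hs⟩
    have h1 : HasDerivWithinAt (fun s => ∫ x in c..s, g' x) (g' s) (Icc c d) s :=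
      intervalIntegral.integral_hasDerivWithinAt_right (hi' s hs)
        (hg'.continuousOn.stronglyMeasurableAtFilter_nhdsWithin measurableSet_Icc s)
        (hg'.continuousOn s hs)
    exact (h1.const_add _).congr hH (hH s hs)
  refine ⟨hi d ⟨hcd.le, le_rfl⟩, ?_, hder⟩
  have hu := uniqueDiffOn_Icc hcd
  refine (contDiffOn_infty_iff_derivWithin hu).2 ⟨fun s hs => (hder s hs).differentiableWithinAt, ?_⟩
  exact hg'.congr fun s hs => (hder s hs).derivWithin (hu s hs)

section Inverse

variable {u φ : ℝ → ℝ} {a b c d : ℝ}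

theorem continuousOn_inverse (hmono : StrictMonoOn u (Icc a b))
    (hmaps : MapsTo φ (Icc (u a) (u b)) (Icc a b))
    (hinv : ∀ y ∈ Icc (u a) (u b), u (φ y) = y) : ContinuousOn φ (Icc (u a) (u b)) := by
  intro y hy
  have hx := hmaps hy
  refine tendsto_order.2 ⟨fun p hp => ?_, fun p hp => ?_⟩
  · rcases lt_or_ge p a with h | h
    · filter_upwards [self_mem_nhdsWithin] with z hz using h.trans_le (hmaps hz).1
    have hpm : p ∈ Icc a b := ⟨h, hp.le.trans hx.2⟩
    have h1 : u p < y := by rw [← hinv y hy]; exact hmono hpm hx hp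
    filter_upwards [self_mem_nhdsWithin, mem_nhdsWithin_of_mem_nhds (lt_mem_nhds h1)] with z hz h2
    rw [← hmono.lt_iff_lt hpm (hmaps hz), hinv z hz]
    exact h2
  · rcases lt_or_ge b p with h | h
    · filter_upwards [self_mem_nhdsWithin] with z hz using (hmaps hz).2.trans_lt h
    have hpm : p ∈ Icc a b := ⟨hx.1.trans hp.le, h⟩
    have h1 : y < u p := by rw [← hinv y hy]; exact hmono hx hpm hp
    filter_upwards [self_mem_nhdsWithin, mem_nhdsWithin_of_mem_nhds (gt_mem_nhds h1)] with z hz h2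
    rw [← hmono.lt_iff_lt (hmaps hz) hpm, hinv z hz]
    exact h2

theorem strictMonoOn_of_derivWithin_pos (hu : ContDiffOn ℝ ∞ u (Icc c d))
    (hpos : ∀ s ∈ Icc c d, 0 < derivWithin u (Icc c d) s) : StrictMonoOn u (Icc c d) := by
  refine strictMonoOn_of_deriv_pos (convex_Icc c d) hu.continuousOn fun x hx => ?_
  rw [interior_Icc] at hx
  rw [← derivWithin_of_mem_nhds (Icc_mem_nhds hx.1 hx.2)]
  exact hpos x (Ioo_subset_Icc_self hx)

/-- Bootstrapping: `φ' = 1 / (u' ∘ φ)`, so `φ` of class `C^n` has a derivative of class `C^n`. -/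
theorem contDiffOn_inverse (hcd : c < d) (hu : ContDiffOn ℝ ∞ u (Icc c d))
    (hpos : ∀ s ∈ Icc c d, 0 < derivWithin u (Icc c d) s)
    (hmaps : MapsTo φ (Icc (u c) (u d)) (Icc c d))
    (hinv : ∀ y ∈ Icc (u c) (u d), u (φ y) = y) :
    ContDiffOn ℝ ∞ φ (Icc (u c) (u d)) ∧
    ∀ y ∈ Icc (u c) (u d),
      HasDerivWithinAt φ (derivWithin u (Icc c d) (φ y))⁻¹ (Icc (u c) (u d)) y := by
  have hmono := strictMonoOn_of_derivWithin_pos hu hpos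
  have hcont := continuousOn_inverse hmono hmaps hinv
  have hlt : u c < u d := hmono ⟨le_rfl, hcd.le⟩ ⟨hcd.le, le_rfl⟩ hcd
  have huD := uniqueDiffOn_Icc hcd
  have huD' := uniqueDiffOn_Icc hlt
  have hder : ∀ y ∈ Icc (u c) (u d),
      HasDerivWithinAt φ (derivWithin u (Icc c d) (φ y))⁻¹ (Icc (u c) (u d)) y := by
    intro y hy
    have hp := hpos _ (hmaps hy)
    have hd : HasDerivWithinAt u (derivWithin u (Icc c d) (φ y)) (Icc c d) (φ y) :=
      (hu.differentiableOn (by simp) _ (hmaps hy)).hasDerivWithinAt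
    have := HasFDerivWithinAt.of_local_left_inverse (g := φ) (f := u) (a := y)
      (s := Icc (u c) (u d)) (t := Icc c d)
      (f' := ContinuousLinearEquiv.unitsEquivAut ℝ (Units.mk0 _ hp.ne'))
      (tendsto_nhdsWithin_iff.2 ⟨hcont y hy, by
        filter_upwards [self_mem_nhdsWithin] with z hz using hmaps hz⟩)
      (by
        refine hd.hasFDerivWithinAt.congr_fderiv ?_
        ext; simp) hy
      (by filter_upwards [self_mem_nhdsWithin] with z hz using hinv z hz)
    exact this.hasDerivWithinAt.congr_deriv (by simp [ContinuousLinearEquiv.unitsEquivAut])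
  refine ⟨contDiffOn_infty.2 fun n => ?_, hder⟩
  have hu' : ContDiffOn ℝ ∞ (derivWithin u (Icc c d)) (Icc c d) :=
    ((contDiffOn_infty_iff_derivWithin huD).1 hu).2
  induction n with
  | zero => exact contDiffOn_zero.2 hcont
  | succ n ih =>
    refine (contDiffOn_succ_iff_derivWithin (n := (n : WithTop ℕ∞)) huD').2
      ⟨fun y hy => (hder y hy).differentiableWithinAt, fun h => absurd h (by exact_mod_cast WithTop.coe_ne_top), ?_⟩
    have h1 : ContDiffOn ℝ n (fun y => (derivWithin u (Icc c d) (φ y))⁻¹) (Icc (u c) (u d)) :=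
      ((hu'.of_le (by exact_mod_cast le_top)).comp ih hmaps).inv fun y hy => (hpos _ (hmaps hy)).ne'
    exact h1.congr fun y hy => (hder y hy).derivWithin (huD' y hy)

end Inverse

/-! ### Calculus on strips around `r = 0`. -/

/-- The strip `(-δ, δ) × [c, d]`. -/
abbrev strip (δ c d : ℝ) : Set (ℝ × ℝ) := Ioo (-δ) δ ×ˢ Icc c d

section Strip

variable {f g : ℝ × ℝ → ℝ} {δ c d : ℝ}

theorem strip_mono {δ' c' d' : ℝ} (hδ : δ' ≤ δ) (hc : c ≤ c') (hd : d' ≤ d) :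
    strip δ' c' d' ⊆ strip δ c d :=
  prod_mono (Ioo_subset_Ioo (neg_le_neg hδ) hδ) (Icc_subset_Icc hc hd)

theorem uniqueDiffOn_strip (hcd : c < d) : UniqueDiffOn ℝ (strip δ c d) :=
  isOpen_Ioo.uniqueDiffOn.prod (uniqueDiffOn_Icc hcd)

theorem exists_deriv_fst (hcd : c < d) (hf : ContDiffOn ℝ ∞ f (strip δ c d)) :
    ∃ g : ℝ × ℝ → ℝ, ContDiffOn ℝ ∞ g (strip δ c d) ∧
      ∀ r ∈ Ioo (-δ) δ, ∀ s ∈ Icc c d, HasDerivAt (fun r => f (r, s)) (g (r, s)) r := by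
  refine ⟨fun z => fderivWithin ℝ f (strip δ c d) z (1, 0),
    (hf.fderivWithin (m := ∞) (uniqueDiffOn_strip hcd) (by simp)).clm_apply contDiffOn_const, ?_⟩
  intro r hr s hs
  have h1 : HasFDerivWithinAt f (fderivWithin ℝ f (strip δ c d) (r, s)) (strip δ c d) (r, s) :=
    (hf.differentiableOn (by simp) (r, s) ⟨hr, hs⟩).hasFDerivWithinAt
  have h2 : HasDerivWithinAt (fun r : ℝ => ((r, s) : ℝ × ℝ)) (1, 0) (Ioo (-δ) δ) r :=
    ((hasDerivAt_id r).prodMk (hasDerivAt_const r s)).hasDerivWithinAt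
  have h3 : MapsTo (fun r : ℝ => ((r, s) : ℝ × ℝ)) (Ioo (-δ) δ) (strip δ c d) :=
    fun x hx => ⟨hx, hs⟩
  exact (h1.comp_hasDerivWithinAt r h2 h3).hasDerivAt (isOpen_Ioo.mem_nhds hr)

theorem exists_deriv_snd (hcd : c < d) (hf : ContDiffOn ℝ ∞ f (strip δ c d)) :
    ∃ g : ℝ × ℝ → ℝ, ContDiffOn ℝ ∞ g (strip δ c d) ∧
      ∀ r ∈ Ioo (-δ) δ, ∀ s ∈ Icc c d,
        HasDerivWithinAt (fun s => f (r, s)) (g (r, s)) (Icc c d) s := by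
  refine ⟨fun z => fderivWithin ℝ f (strip δ c d) z (0, 1),
    (hf.fderivWithin (m := ∞) (uniqueDiffOn_strip hcd) (by simp)).clm_apply contDiffOn_const, ?_⟩
  intro r hr s hs
  have h1 : HasFDerivWithinAt f (fderivWithin ℝ f (strip δ c d) (r, s)) (strip δ c d) (r, s) :=
    (hf.differentiableOn (by simp) (r, s) ⟨hr, hs⟩).hasFDerivWithinAt
  have h2 : HasDerivWithinAt (fun s : ℝ => ((r, s) : ℝ × ℝ)) (0, 1) (Icc c d) s :=
    ((hasDerivAt_const s r).prodMk (hasDerivAt_id s)).hasDerivWithinAt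
  have h3 : MapsTo (fun s : ℝ => ((r, s) : ℝ × ℝ)) (Icc c d) (strip δ c d) :=
    fun x hx => ⟨hr, hx⟩
  exact h1.comp_hasDerivWithinAt s h2 h3

theorem continuousOn_slice (hf : ContinuousOn f (strip δ c d)) {r : ℝ} (hr : r ∈ Ioo (-δ) δ) :
    ContinuousOn (fun s => f (r, s)) (Icc c d) :=
  by
  have h : MapsTo (fun s : ℝ => (r, s)) (Icc c d) (strip δ c d) := fun s hs => ⟨hr, hs⟩
  exact hf.comp (by fun_prop) h

/-- The tube lemma over the compact interval `[c, d]`. -/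
theorem exists_strip_pos (hδ : 0 < δ) (hf : ContinuousOn f (strip δ c d))
    (hpos : ∀ s ∈ Icc c d, 0 < f (0, s)) :
    ∃ δ' ∈ Ioc 0 δ, ∀ r ∈ Ioo (-δ') δ', ∀ s ∈ Icc c d, 0 < f (r, s) := by
  obtain ⟨U, hU, hUeq⟩ := continuousOn_iff'.1 hf (Ioi 0) isOpen_Ioi
  have h0 : (0 : ℝ) ∈ Ioo (-δ) δ := ⟨by linarith, hδ⟩
  have hsub : ({0} : Set ℝ) ×ˢ Icc c d ⊆ U := by
    rintro ⟨r, s⟩ ⟨hr, hs⟩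
    obtain rfl : r = 0 := hr
    have : ((0 : ℝ), s) ∈ f ⁻¹' Ioi 0 ∩ strip δ c d := ⟨hpos s hs, h0, hs⟩
    rw [hUeq] at this
    exact this.1
  obtain ⟨V, W, hV, -, h0V, hW, hVW⟩ :=
    generalized_tube_lemma isCompact_singleton isCompact_Icc hU hsub
  obtain ⟨η, hη, hball⟩ := Metric.isOpen_iff.1 hV 0 (h0V rfl)
  refine ⟨min η δ, ⟨lt_min hη hδ, min_le_right _ _⟩, fun r hr s hs => ?_⟩
  have hrδ : r ∈ Ioo (-δ) δ :=
    ⟨(neg_le_neg (min_le_right η δ)).trans_lt hr.1, hr.2.trans_le (min_le_right _ _)⟩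
  have hrη : r ∈ V := hball (by
    rw [Metric.mem_ball, Real.dist_eq, sub_zero, abs_lt]
    exact ⟨(neg_le_neg (min_le_left η δ)).trans_lt hr.1, hr.2.trans_le (min_le_left _ _)⟩)
  have : (r, s) ∈ U ∩ strip δ c d := ⟨hVW ⟨hrη, hW hs⟩, hrδ, hs⟩
  rw [← hUeq] at this
  exact this.1

/-- By the tube lemma `∂_r f < 0` on a whole thinner strip, so `f` decreases strictly from zero,
uniformly in `s`. -/
theorem exists_strip_neg_of_deriv_neg (hδ : 0 < δ) (hg : ContinuousOn g (strip δ c d))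
    (hfg : ∀ r ∈ Ioo (-δ) δ, ∀ s ∈ Icc c d, HasDerivAt (fun r => f (r, s)) (g (r, s)) r)
    (hf0 : ∀ s ∈ Icc c d, f (0, s) = 0) (hg0 : ∀ s ∈ Icc c d, g (0, s) < 0) :
    ∃ δ' ∈ Ioc 0 δ, ∀ r ∈ Ioo 0 δ', ∀ s ∈ Icc c d, f (r, s) < 0 := by
  obtain ⟨δ', hδ', h⟩ := exists_strip_pos (f := fun z => -g z) hδ hg.neg
    fun s hs => neg_pos.2 (hg0 s hs)
  refine ⟨δ', hδ', fun r hr s hs => ?_⟩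
  have hsub : ∀ x ∈ Icc 0 r, x ∈ Ioo (-δ') δ' := fun x hx =>
    ⟨by linarith [hx.1, hr.1, hδ'.1], hx.2.trans_lt hr.2⟩
  have hsub' : ∀ x ∈ Icc 0 r, x ∈ Ioo (-δ) δ := fun x hx =>
    ⟨by linarith [(hsub x hx).1, hδ'.2], (hsub x hx).2.trans_le hδ'.2⟩
  have hanti : StrictAntiOn (fun r => f (r, s)) (Icc 0 r) := by
    refine strictAntiOn_of_deriv_neg (convex_Icc 0 r)
      (fun x hx => (hfg x (hsub' x hx) s hs).continuousAt.continuousWithinAt) fun x hx => ?_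
    have hx' := interior_subset hx
    rw [(hfg x (hsub' x hx') s hs).deriv]
    have := h x (hsub x hx') s hs
    linarith
  simpa [hf0 s hs] using hanti ⟨le_rfl, hr.1.le⟩ ⟨hr.1.le, le_rfl⟩ hr.1

theorem hasDerivAt_integral_strip (hδ : 0 < δ) (hcd : c < d) (hf : ContinuousOn f (strip δ c d))
    (hg : ContinuousOn g (strip δ c d))
    (hfg : ∀ r ∈ Ioo (-δ) δ, ∀ s ∈ Icc c d, HasDerivAt (fun r => f (r, s)) (g (r, s)) r) :
    HasDerivAt (fun r => ∫ s in c..d, f (r, s)) (∫ s in c..d, g (0, s)) 0 := by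
  have h0 : (0 : ℝ) ∈ Ioo (-δ) δ := ⟨by linarith, hδ⟩
  -- The closed half-width strip is compact, so `g` is bounded there; this bound serves as the
  -- dominating function.
  have hsub : Icc (-(δ / 2)) (δ / 2) ⊆ Ioo (-δ) δ := fun x hx =>
    ⟨by linarith [hx.1], by linarith [hx.2]⟩
  obtain ⟨C, hC⟩ := (isCompact_Icc.prod isCompact_Icc).exists_bound_of_continuousOn
    (hg.mono (prod_mono hsub (Subset.refl (Icc c d))))
  have hmem : ∀ {t : ℝ}, t ∈ uIoc c d → t ∈ Icc c d := fun {t} ht => by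
    rw [uIoc_of_le hcd.le] at ht; exact Ioc_subset_Icc_self ht
  have hmeas : ∀ {k : ℝ → ℝ}, ContinuousOn k (Icc c d) →
      AEStronglyMeasurable k (volume.restrict (uIoc c d)) := fun {k} hk => by
    rw [uIoc_of_le hcd.le]
    exact (hk.mono Ioc_subset_Icc_self).aestronglyMeasurable measurableSet_Ioc
  refine (intervalIntegral.hasDerivAt_integral_of_dominated_loc_of_deriv_le
    (F := fun r s => f (r, s)) (F' := fun r s => g (r, s)) (bound := fun _ => C)
    (Icc_mem_nhds (by linarith : -(δ / 2) < 0) (by linarith : (0 : ℝ) < δ / 2)) ?_ ?_ ?_ ?_ ?_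
    ?_).2
  · filter_upwards [isOpen_Ioo.mem_nhds h0] with r hr using hmeas (continuousOn_slice hf hr)
  · exact (continuousOn_slice hf h0).intervalIntegrable_of_Icc hcd.le
  · exact hmeas (continuousOn_slice hg h0)
  · exact Filter.Eventually.of_forall fun t ht x hx => hC (x, t) ⟨hx, hmem ht⟩
  · exact intervalIntegrable_const
  · exact Filter.Eventually.of_forall fun t ht x hx => hfg x (hsub hx) t (hmem ht)

end Strip

/-! ### Causal character of vectors in terms of `L` and `τ`. -/

namespace Spacetime

theorem inT_iff {E : Type*} [NormedAddCommGroup E] [NormedSpace ℝ E] {M : Type*}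
    [TopologicalSpace M] [ChartedSpace E M] (p : ℝ × M) (v : Tan E p) : InT p v ↔ v.2 = 0 := by
  constructor
  · rintro ⟨c, rfl⟩
    simp [dt]
  · intro h
    exact ⟨v.1, Prod.ext (by simp [dt]) (by simp [dt, h])⟩

variable {E : Type*} [NormedAddCommGroup E] [NormedSpace ℝ E]
  {M : Type*} [TopologicalSpace M] [ChartedSpace E M] [IsManifold 𝓘(ℝ, E) ∞ M]
  (S : Spacetime E M)

theorem F_zero (x : M) : S.F.toFun x (0 : TangentSpace 𝓘(ℝ, E) x) = 0 := by
  simpa using S.F.homogeneous x 0 0 le_rfl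

theorem L_smul (p : ℝ × M) (v : Tan E p) {c : ℝ} (hc : 0 ≤ c) :
    S.L p (c • v) = c ^ 2 * S.L p v := by
  simp only [L, Prod.smul_fst, Prod.smul_snd, S.F.homogeneous p.2 v.2 c hc, smul_eq_mul]
  ring

/-- Euler's relation: on the ray through `v` the function is `(1 + r + s)² L(v)`. No smoothness
enters, so the identity holds on `𝒯` as well. -/
theorem gTilde_self (p : ℝ × M) (v : Tan E p) : S.gTilde p v v v = S.L p v := by
  have h1 : ∀ r s : ℝ, 0 ≤ 1 + r + s → S.L p (v + r • v + s • v) = (1 + r + s) ^ 2 * S.L p v := by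
    intro r s h
    rw [← S.L_smul p v h, add_smul, add_smul, one_smul]
  have h2 : ∀ r : ℝ, -1 < r → deriv (fun s : ℝ => S.L p (v + r • v + s • v)) 0
      = 2 * (1 + r) * S.L p v := by
    intro r hr
    have : (fun s : ℝ => S.L p (v + r • v + s • v)) =ᶠ[𝓝 0]
        fun s => (1 + r + s) ^ 2 * S.L p v := by
      filter_upwards [lt_mem_nhds (show -1 - r < (0 : ℝ) by linarith)] with s hs
      exact h1 r s (by linarith)
    rw [this.deriv_eq]
    have h3 : HasDerivAt (fun s : ℝ => (1 + r + s) ^ 2 * S.L p v)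
        (2 * (1 + r + 0) * S.L p v) 0 := by
      have := (((hasDerivAt_id (0 : ℝ)).const_add (1 + r)).pow 2).mul_const (S.L p v)
      refine this.congr_deriv (by simp)
    rw [h3.deriv, add_zero]
  have h4 : (fun r : ℝ => deriv (fun s : ℝ => S.L p (v + r • v + s • v)) 0) =ᶠ[𝓝 0]
      fun r => 2 * (1 + r) * S.L p v := by
    filter_upwards [lt_mem_nhds (show (-1 : ℝ) < 0 by norm_num)] with r hr using h2 r hr
  have h5 : HasDerivAt (fun r : ℝ => 2 * (1 + r) * S.L p v) (2 * S.L p v) 0 := by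
    have := ((((hasDerivAt_id (0 : ℝ)).const_add 1).const_mul 2).mul_const (S.L p v))
    exact this.congr_deriv (by simp)
  rw [gTilde, vertHessian, h4.deriv_eq, h5.deriv]
  ring

/-- The Finsler term does not involve the `∂_t` direction, so only `-Λτ²` contributes. -/
theorem gTilde_dt (p : ℝ × M) (v : Tan E p) : S.gTilde p v v (dt p) = -S.lapse p.2 * v.1 := by
  have h1 : ∀ r s : ℝ, S.L p (v + r • v + s • dt p)
      = -S.lapse p.2 * (v.1 + r * v.1 + s) ^ 2 + S.F.toFun p.2 (v.2 + r • v.2) ^ 2 := by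
    intro r s
    simp [L, dt]
  have h2 : ∀ r : ℝ, deriv (fun s : ℝ => S.L p (v + r • v + s • dt p)) 0
      = -S.lapse p.2 * (2 * (v.1 + r * v.1)) := by
    intro r
    simp only [h1]
    have := ((((hasDerivAt_id (0 : ℝ)).const_add (v.1 + r * v.1)).pow 2).const_mul
      (-S.lapse p.2)).add_const (S.F.toFun p.2 (v.2 + r • v.2) ^ 2)
    exact (this.congr_deriv (by simp)).deriv
  have h3 : HasDerivAt (fun r : ℝ => -S.lapse p.2 * (2 * (v.1 + r * v.1)))
      (-S.lapse p.2 * (2 * v.1)) 0 := by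
    have := ((((hasDerivAt_id (0 : ℝ)).mul_const v.1).const_add v.1).const_mul 2).const_mul
      (-S.lapse p.2)
    exact this.congr_deriv (by simp)
  rw [gTilde, vertHessian]
  simp only [h2]
  rw [h3.deriv]
  ring

theorem futurePointing_iff (p : ℝ × M) (v : Tan E p) : S.FuturePointing p v ↔ 0 < v.1 := by
  rw [FuturePointing, inT_iff, gTilde_dt]
  have hΛ := S.lapse_pos p.2
  have e : -S.lapse p.2 * v.1 < 0 ↔ 0 < v.1 := by
    rw [neg_mul, neg_lt_zero, mul_pos_iff_of_pos_left hΛ]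
  rw [e]
  constructor
  · rintro (⟨c, hc, rfl⟩ | h)
    · simpa [dt] using hc
    · exact h.2
  · intro h
    by_cases h2 : v.2 = 0
    · exact Or.inl ⟨v.1, h, Prod.ext (by simp [dt]) (by simp [dt, h2])⟩
    · exact Or.inr ⟨h2, h⟩

theorem timelike_iff (p : ℝ × M) (v : Tan E p) : S.Timelike p v ↔ S.L p v < 0 := by
  rw [Timelike, inT_iff, gTilde_self]
  by_cases h2 : v.2 = 0
  · have hΛ := S.lapse_pos p.2
    have hL : S.L p v = -(S.lapse p.2 * v.1 ^ 2) := by simp [L, h2, F_zero]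
    have hv : v ≠ 0 ↔ v.1 ≠ 0 := by
      refine not_congr ⟨fun h => by rw [h]; rfl, fun h => Prod.ext h h2⟩
    simp only [h2, hL, hv, true_and, not_true_eq_false, false_and, or_false, neg_lt_zero]
    rw [mul_pos_iff_of_pos_left hΛ, sq_pos_iff]
  · simp [h2]

theorem lightlike_iff (p : ℝ × M) (v : Tan E p) : S.Lightlike p v ↔ v.2 ≠ 0 ∧ S.L p v = 0 := by
  rw [Lightlike, inT_iff, gTilde_self]

/-- Timelike and future-pointing. -/
def FutureTimelike (p : ℝ × M) (v : Tan E p) : Prop := S.L p v < 0 ∧ 0 < v.1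

/-- Causal and future-pointing. -/
def FutureCausal (p : ℝ × M) (v : Tan E p) : Prop := S.L p v ≤ 0 ∧ 0 < v.1

/-- Lightlike, future-pointing, and of unit energy with respect to `∂_t`. -/
def UnitLightlike (p : ℝ × M) (v : Tan E p) : Prop :=
  v.2 ≠ 0 ∧ S.L p v = 0 ∧ S.lapse p.2 * v.1 = 1

theorem timelike_and_future_iff (p : ℝ × M) (v : Tan E p) :
    S.Timelike p v ∧ S.FuturePointing p v ↔ S.FutureTimelike p v := by
  rw [timelike_iff, futurePointing_iff, FutureTimelike]

theorem causal_and_future_iff (p : ℝ × M) (v : Tan E p) :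
    S.Causal p v ∧ S.FuturePointing p v ↔ S.FutureCausal p v := by
  rw [Causal, timelike_iff, lightlike_iff, futurePointing_iff, FutureCausal]
  constructor
  · rintro ⟨h | h, h'⟩
    · exact ⟨h.le, h'⟩
    · exact ⟨h.2.le, h'⟩
  · rintro ⟨h, h'⟩
    rcases h.lt_or_eq with h1 | h1
    · exact ⟨Or.inl h1, h'⟩
    · refine ⟨Or.inr ⟨fun h2 => ?_, h1⟩, h'⟩
      have : S.L p v = -(S.lapse p.2 * v.1 ^ 2) := by simp [L, h2, F_zero]
      have := mul_pos (S.lapse_pos p.2) (pow_pos h' 2)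
      linarith

theorem FutureTimelike.futureCausal {p : ℝ × M} {v : Tan E p} (h : S.FutureTimelike p v) :
    S.FutureCausal p v := ⟨h.1.le, h.2⟩

end Spacetime

/-! ### One-sided velocities and smooth pieces. -/

section Velocity

variable {E : Type*} [NormedAddCommGroup E] [NormedSpace ℝ E]
  {M : Type*} [TopologicalSpace M] [ChartedSpace E M]

variable (E) in
/-- `γ` is smooth on `[c, d]` and its velocities there satisfy `P`. -/
def PieceSat (P : (p : ℝ × M) → Tan E p → Prop) (γ : ℝ → ℝ × M) (c d : ℝ) : Prop :=
  ContMDiffOn 𝓘(ℝ, ℝ) (𝓘(ℝ, ℝ).prod 𝓘(ℝ, E)) ∞ γ (Icc c d) ∧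
  ∀ s ∈ Icc c d, P (γ s) (velocityWithin E γ (Icc c d) s)

variable {γ : ℝ → ℝ × M} {P Q : (p : ℝ × M) → Tan E p → Prop} {a b c d : ℝ}

theorem contMDiffOn_curve_iff {A : Set ℝ} :
    ContMDiffOn 𝓘(ℝ, ℝ) (𝓘(ℝ, ℝ).prod 𝓘(ℝ, E)) ∞ γ A ↔
      ContDiffOn ℝ ∞ (fun s => (γ s).1) A ∧
      ContMDiffOn 𝓘(ℝ, ℝ) 𝓘(ℝ, E) ∞ (fun s => (γ s).2) A := by
  rw [contMDiffOn_prod_iff, contMDiffOn_iff_contDiffOn]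
  rfl

theorem velocityWithin_eq {A B : Set ℝ} {s : ℝ}
    (hγ : ContMDiffOn 𝓘(ℝ, ℝ) (𝓘(ℝ, ℝ).prod 𝓘(ℝ, E)) ∞ γ A) (hs : s ∈ A)
    (hB : UniqueDiffWithinAt ℝ B s) (hAB : A ∈ 𝓝[B] s) :
    velocityWithin E γ B s = velocityWithin E γ A s := by
  rw [contMDiffOn_curve_iff] at hγ
  refine Prod.ext ?_ ?_
  · exact derivWithin_of_mem_nhdsWithin hAB hB (hγ.1.differentiableOn (by simp) s hs)
  · have := (hγ.2.mdifferentiableOn (by simp) s hs).mfderivWithin_mono_of_mem_nhdsWithin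
      hB.uniqueMDiffWithinAt hAB
    exact congrArg (fun f : ℝ →L[ℝ] E => f 1) this

theorem velocityRight_eq {s : ℝ}
    (hγ : ContMDiffOn 𝓘(ℝ, ℝ) (𝓘(ℝ, ℝ).prod 𝓘(ℝ, E)) ∞ γ (Icc c d)) (hs : s ∈ Ico c d) :
    velocityRight E γ s = velocityWithin E γ (Icc c d) s :=
  velocityWithin_eq hγ (Ico_subset_Icc_self hs) (uniqueDiffOn_Ici s s self_mem_Ici) (by
    filter_upwards [self_mem_nhdsWithin, mem_nhdsWithin_of_mem_nhds (gt_mem_nhds hs.2)] with x h1 h2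
    exact ⟨hs.1.trans h1, le_of_lt h2⟩)

theorem velocityLeft_eq {s : ℝ}
    (hγ : ContMDiffOn 𝓘(ℝ, ℝ) (𝓘(ℝ, ℝ).prod 𝓘(ℝ, E)) ∞ γ (Icc c d)) (hs : s ∈ Ioc c d) :
    velocityLeft E γ s = velocityWithin E γ (Icc c d) s :=
  velocityWithin_eq hγ (Ioc_subset_Icc_self hs) (uniqueDiffOn_Iic s s self_mem_Iic) (by
    filter_upwards [self_mem_nhdsWithin, mem_nhdsWithin_of_mem_nhds (lt_mem_nhds hs.1)] with x h1 h2
    exact ⟨le_of_lt h2, le_trans h1 hs.2⟩)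

theorem PieceSat.mono {c' d' : ℝ} (h : PieceSat E P γ c d) (hc : c ≤ c') (hcd : c' < d')
    (hd : d' ≤ d) : PieceSat E P γ c' d' := by
  have hsub := Icc_subset_Icc hc hd
  refine ⟨h.1.mono hsub, fun s hs => ?_⟩
  rw [velocityWithin_eq h.1 (hsub hs) (uniqueDiffOn_Icc hcd s hs)
    (Filter.mem_of_superset self_mem_nhdsWithin hsub)]
  exact h.2 s (hsub hs)

theorem PieceSat.imp (h : PieceSat E P γ c d) (hPQ : ∀ p v, P p v → Q p v) :
    PieceSat E Q γ c d := ⟨h.1, fun s hs => hPQ _ _ (h.2 s hs)⟩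

theorem hereditary_pieceSat (P : (p : ℝ × M) → Tan E p → Prop) (γ : ℝ → ℝ × M) :
    Hereditary (PieceSat E P γ) := fun _ _ _ _ h h1 h2 h3 => h.mono h1 h2 h3

theorem continuousOn_union_of_closure {X Y : Type*} [TopologicalSpace X] [TopologicalSpace Y]
    {f : X → Y} {A B : Set X} (hA : closure A ∩ B ⊆ A) (hB : closure B ∩ A ⊆ B)
    (h1 : ContinuousOn f A) (h2 : ContinuousOn f B) : ContinuousOn f (A ∪ B) := by
  intro z hz
  refine ContinuousWithinAt.union ?_ ?_
  · by_cases h : z ∈ closure A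
    · exact h1 z (hz.elim id fun hB => hA ⟨h, hB⟩)
    · exact continuousWithinAt_of_notMem_closure h
  · by_cases h : z ∈ closure B
    · exact h2 z (hz.elim (fun hA => hB ⟨h, hA⟩) id)
    · exact continuousWithinAt_of_notMem_closure h

theorem continuousOn_prod_Icc_union {X Y : Type*} [TopologicalSpace X] [TopologicalSpace Y]
    {f : X × ℝ → Y} {U : Set X} (hab : a ≤ b) (hbc : b ≤ c) (h1 : ContinuousOn f (U ×ˢ Icc a b))
    (h2 : ContinuousOn f (U ×ˢ Icc b c)) : ContinuousOn f (U ×ˢ Icc a c) := by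
  rw [← Icc_union_Icc_eq_Icc hab hbc, prod_union]
  refine continuousOn_union_of_closure ?_ ?_ h1 h2 <;>
  · rw [closure_prod_eq, isClosed_Icc.closure_eq]
    exact fun z hz => ⟨hz.2.1, hz.1.2⟩

theorem continuousOn_Icc_union {X : Type*} [TopologicalSpace X] {f : ℝ → X} (hab : a ≤ b)
    (hbc : b ≤ c) (h1 : ContinuousOn f (Icc a b)) (h2 : ContinuousOn f (Icc b c)) :
    ContinuousOn f (Icc a c) := by
  rw [← Icc_union_Icc_eq_Icc hab hbc]
  exact h1.union_of_isClosed h2 isClosed_Icc isClosed_Icc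

theorem isCurve_iff (hab : a < b) : IsCurve E γ a b ↔ PiecewiseOn (fun c d =>
    ContMDiffOn 𝓘(ℝ, ℝ) (𝓘(ℝ, ℝ).prod 𝓘(ℝ, E)) ∞ γ (Icc c d)) a b := by
  refine ⟨fun h => h.2, fun h => ⟨?_, h⟩⟩
  refine (h.induct (Q := fun c d => c ≤ d ∧ ContinuousOn γ (Icc c d)) hab ?_ ?_).2
  · exact fun c d _ hcd _ h => ⟨hcd.le, h.continuousOn⟩
  · exact fun c d h1 h2 _ h3 h4 =>
      ⟨h1.le.trans h2.le, continuousOn_Icc_union h1.le h2.le h3.2 h4.2⟩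

/-- On a smooth piece every one-sided derivative equals the derivative within the closed piece. This
converts the pointwise conditions of the definitions into conditions on pieces. -/
theorem isCurve_and_velocitiesSatisfy_iff (hab : a < b) :
    IsCurve E γ a b ∧ VelocitiesSatisfy E P γ a b ↔ PiecewiseOn (PieceSat E P γ) a b := by
  constructor
  · rintro ⟨h1, h2⟩
    refine ((isCurve_iff hab).1 h1).mono fun c d hac hcd hdb h => ⟨h, fun s hs => ?_⟩
    rcases hs.2.lt_or_eq with h3 | h3
    · rw [← velocityRight_eq h ⟨hs.1, h3⟩]
      exact h2.1 s ⟨hac.trans hs.1, h3.trans_le hdb⟩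
    · rw [← velocityLeft_eq h ⟨h3 ▸ hcd, hs.2⟩]
      exact h2.2 s ⟨hac.trans_lt (h3 ▸ hcd), hs.2.trans hdb⟩
  · intro h
    refine ⟨(isCurve_iff hab).2 (h.mono fun c d _ _ _ h => h.1), fun s hs => ?_, fun s hs => ?_⟩
    · obtain ⟨c, d, -, -, hs, h1⟩ := h.right hs
      rw [velocityRight_eq h1.1 hs]
      exact h1.2 s (Ico_subset_Icc_self hs)
    · obtain ⟨c, d, -, -, hs, h1⟩ := h.left hs
      rw [velocityLeft_eq h1.1 hs]
      exact h1.2 s (Ioc_subset_Icc_self hs)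

theorem transport_tan {p q : ℝ × M} (hpq : p = q) {v : Tan E p} {w : Tan E q}
    (h1 : v.1 = w.1) (h2 : (v.2 : E) = w.2) (h : P p v) : P q w := by
  subst hpq
  obtain rfl : v = w := Prod.ext h1 h2
  exact h

theorem PieceSat.congr {γ' : ℝ → ℝ × M} (h : PieceSat E P γ c d) (heq : EqOn γ' γ (Icc c d)) :
    PieceSat E P γ' c d := by
  refine ⟨h.1.congr heq, fun s hs => transport_tan (heq hs).symm ?_ ?_ (h.2 s hs)⟩
  · exact (derivWithin_congr (fun x hx => congrArg Prod.fst (heq hx))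
      (congrArg Prod.fst (heq hs))).symm
  · exact congrArg (fun f : ℝ →L[ℝ] E => f 1) (mfderivWithin_congr (I := 𝓘(ℝ, ℝ)) (I' := 𝓘(ℝ, E))
      (fun x hx => congrArg Prod.snd (heq hx)) (congrArg Prod.snd (heq hs))).symm

theorem velocityWithin_comp {φ : ℝ → ℝ} {A B : Set ℝ} {s φ' : ℝ}
    (hγ : ContMDiffOn 𝓘(ℝ, ℝ) (𝓘(ℝ, ℝ).prod 𝓘(ℝ, E)) ∞ γ B)
    (hφ : HasDerivWithinAt φ φ' A s) (hAB : MapsTo φ A B) (hs : s ∈ A)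
    (hA : UniqueDiffWithinAt ℝ A s) :
    velocityWithin E (γ ∘ φ) A s = φ' • (velocityWithin E γ B (φ s) : Tan E (γ (φ s))) := by
  rw [contMDiffOn_curve_iff] at hγ
  refine Prod.ext ?_ ?_
  · have h1 := (hγ.1.differentiableOn (by simp) _ (hAB hs)).hasDerivWithinAt
    exact ((h1.scomp s hφ hAB).derivWithin hA).trans (by simp [velocityWithin])
  · have h1 := hγ.2.mdifferentiableOn (by simp) _ (hAB hs)
    have h2 : mfderivWithin 𝓘(ℝ, ℝ) 𝓘(ℝ, E) ((fun s => (γ s).2) ∘ φ) A s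
        = (mfderivWithin 𝓘(ℝ, ℝ) 𝓘(ℝ, E) (fun s => (γ s).2) B (φ s)).comp
          (mfderivWithin 𝓘(ℝ, ℝ) 𝓘(ℝ, ℝ) φ A s) :=
      mfderivWithin_comp s h1 hφ.differentiableWithinAt.mdifferentiableWithinAt hAB
        hA.uniqueMDiffWithinAt
    have h3 : mfderivWithin 𝓘(ℝ, ℝ) 𝓘(ℝ, ℝ) φ A s (1 : ℝ) = φ' := by
      rw [mfderivWithin_eq_fderivWithin]
      exact hφ.derivWithin hA
    refine (congrArg (fun f : ℝ →L[ℝ] E => f 1) h2).trans ?_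
    change (mfderivWithin 𝓘(ℝ, ℝ) 𝓘(ℝ, E) (fun s => (γ s).2) B (φ s) : ℝ →L[ℝ] E)
      ((mfderivWithin 𝓘(ℝ, ℝ) 𝓘(ℝ, ℝ) φ A s : ℝ →L[ℝ] ℝ) 1) = φ' •
      (mfderivWithin 𝓘(ℝ, ℝ) 𝓘(ℝ, E) (fun s => (γ s).2) B (φ s) : ℝ →L[ℝ] E) 1
    rw [← map_smul]
    congr 1
    exact h3.trans (mul_one φ').symm

theorem velocityWithin_add {h : ℝ → ℝ} {A : Set ℝ} {s h' : ℝ}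
    (hγ : ContMDiffOn 𝓘(ℝ, ℝ) (𝓘(ℝ, ℝ).prod 𝓘(ℝ, E)) ∞ γ A)
    (hh : HasDerivWithinAt h h' A s) (hs : s ∈ A) (hA : UniqueDiffWithinAt ℝ A s) :
    velocityWithin E (fun s => ((γ s).1 + h s, (γ s).2)) A s =
      ((velocityWithin E γ A s).1 + h', (velocityWithin E γ A s).2) := by
  rw [contMDiffOn_curve_iff] at hγ
  have h1 := (hγ.1.differentiableOn (by simp) _ hs).hasDerivWithinAt
  exact Prod.ext ((h1.add hh).derivWithin hA) rfl

end Velocity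

/-! ### Variations smooth on a strip. -/

section Variation

variable {E : Type*} [NormedAddCommGroup E] [NormedSpace ℝ E]
  {M : Type*} [TopologicalSpace M] [ChartedSpace E M]

variable (E) in
/-- `ψ` is smooth on the strip `(-ε, ε) × [c, d]`. -/
def SmoothStrip (ψ : ℝ → ℝ → ℝ × M) (ε c d : ℝ) : Prop :=
  ContMDiffOn 𝓘(ℝ, ℝ × ℝ) (𝓘(ℝ, ℝ).prod 𝓘(ℝ, E)) ∞ (fun z : ℝ × ℝ => ψ z.1 z.2) (strip ε c d)

variable {ψ : ℝ → ℝ → ℝ × M} {ε c d : ℝ}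

theorem smoothStrip_iff : SmoothStrip E ψ ε c d ↔
    ContDiffOn ℝ ∞ (fun z : ℝ × ℝ => (ψ z.1 z.2).1) (strip ε c d) ∧
    ContMDiffOn 𝓘(ℝ, ℝ × ℝ) 𝓘(ℝ, E) ∞ (fun z : ℝ × ℝ => (ψ z.1 z.2).2) (strip ε c d) := by
  rw [SmoothStrip, contMDiffOn_prod_iff, contMDiffOn_iff_contDiffOn]
  rfl

theorem SmoothStrip.mono {ε' c' d' : ℝ} (h : SmoothStrip E ψ ε c d) (hε : ε' ≤ ε) (hc : c ≤ c')
    (hd : d' ≤ d) : SmoothStrip E ψ ε' c' d' :=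
  ContMDiffOn.mono h (strip_mono hε hc hd)

theorem hereditary_smoothStrip (ψ : ℝ → ℝ → ℝ × M) (ε : ℝ) :
    Hereditary (SmoothStrip E ψ ε) := fun _ _ _ _ h h1 _ h3 => h.mono le_rfl h1 h3

/-- Precomposition with a smooth map between strips. -/
theorem SmoothStrip.comp {ε' c' d' : ℝ} (h : SmoothStrip E ψ ε c d) {g : ℝ × ℝ → ℝ × ℝ}
    (hg : ContDiffOn ℝ ∞ g (strip ε' c' d'))
    (hmaps : MapsTo g (strip ε' c' d') (strip ε c d)) :
    ContMDiffOn 𝓘(ℝ, ℝ × ℝ) (𝓘(ℝ, ℝ).prod 𝓘(ℝ, E)) ∞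
      (fun z : ℝ × ℝ => ψ (g z).1 (g z).2) (strip ε' c' d') :=
  ContMDiffOn.comp (g := fun z : ℝ × ℝ => ψ z.1 z.2) h hg.contMDiffOn hmaps

theorem SmoothStrip.slice (h : SmoothStrip E ψ ε c d) {r : ℝ} (hr : r ∈ Ioo (-ε) ε) :
    ContMDiffOn 𝓘(ℝ, ℝ) (𝓘(ℝ, ℝ).prod 𝓘(ℝ, E)) ∞ (ψ r) (Icc c d) := by
  have h1 : ContDiffOn ℝ ∞ (fun s : ℝ => ((r, s) : ℝ × ℝ)) (Icc c d) := by fun_prop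
  have h2 : MapsTo (fun s : ℝ => ((r, s) : ℝ × ℝ)) (Icc c d) (strip ε c d) :=
    fun s hs => ⟨hr, hs⟩
  exact ContMDiffOn.comp (g := fun z : ℝ × ℝ => ψ z.1 z.2) h h1.contMDiffOn h2

theorem smoothStrip_const {γ : ℝ → ℝ × M}
    (h : ContMDiffOn 𝓘(ℝ, ℝ) (𝓘(ℝ, ℝ).prod 𝓘(ℝ, E)) ∞ γ (Icc c d)) (ε : ℝ) :
    SmoothStrip E (fun _ => γ) ε c d := by
  have h1 : ContDiffOn ℝ ∞ (fun z : ℝ × ℝ => z.2) (strip ε c d) := by fun_prop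
  have h2 : MapsTo (fun z : ℝ × ℝ => z.2) (strip ε c d) (Icc c d) := fun z hz => hz.2
  exact ContMDiffOn.comp (g := γ) h h1.contMDiffOn h2

theorem SmoothStrip.contDiffOn_velocity_fst (h : SmoothStrip E ψ ε c d) (hcd : c < d) :
    ContDiffOn ℝ ∞ (fun z : ℝ × ℝ => (velocityWithin E (ψ z.1) (Icc c d) z.2).1)
      (strip ε c d) := by
  obtain ⟨g, hg, hd⟩ := exists_deriv_snd hcd (smoothStrip_iff.1 h).1
  exact hg.congr fun z hz => (hd z.1 hz.1 z.2 hz.2).derivWithin (uniqueDiffOn_Icc hcd z.2 hz.2)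

/-- The spatial velocity is the tangent map of `(r, s) ↦ σ(r, s)` applied to the constant field `(0,
1)`, hence jointly smooth into the tangent bundle. -/
theorem SmoothStrip.contMDiffOn_velocity_snd [IsManifold 𝓘(ℝ, E) ∞ M]
    (h : SmoothStrip E ψ ε c d) (hcd : c < d) :
    ContMDiffOn 𝓘(ℝ, ℝ × ℝ) 𝓘(ℝ, E).tangent ∞ (fun z : ℝ × ℝ =>
      (⟨(ψ z.1 z.2).2, (velocityWithin E (ψ z.1) (Icc c d) z.2).2⟩ :
        TangentBundle 𝓘(ℝ, E) M)) (strip ε c d) := by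
  have hσ := (smoothStrip_iff.1 h).2
  have hU := uniqueDiffOn_strip (δ := ε) hcd
  have : IsManifold 𝓘(ℝ, E) 1 M := IsManifold.of_le (n := ∞) (by simp)
  have h1 := hσ.contMDiffOn_tangentMapWithin (m := ∞) (by simp) hU.uniqueMDiffOn
  have h2 : ContMDiffOn 𝓘(ℝ, ℝ × ℝ) 𝓘(ℝ, ℝ × ℝ).tangent ∞
      (fun z : ℝ × ℝ => (⟨z, ((0, 1) : ℝ × ℝ)⟩ : TangentBundle 𝓘(ℝ, ℝ × ℝ) (ℝ × ℝ)))
      (strip ε c d) :=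
    contMDiffOn_vectorSpace_iff_contDiffOn.2 contDiffOn_const
  refine (h1.comp h2 fun z hz => hz).congr fun z hz => ?_
  have h3 : HasDerivWithinAt (fun s : ℝ => ((z.1, s) : ℝ × ℝ)) (0, 1) (Icc c d) z.2 :=
    ((hasDerivAt_const z.2 z.1).prodMk (hasDerivAt_id z.2)).hasDerivWithinAt
  have h4 : mfderivWithin 𝓘(ℝ, ℝ) 𝓘(ℝ, E)
      ((fun z : ℝ × ℝ => (ψ z.1 z.2).2) ∘ fun s : ℝ => ((z.1, s) : ℝ × ℝ)) (Icc c d) z.2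
      = (mfderivWithin 𝓘(ℝ, ℝ × ℝ) 𝓘(ℝ, E) (fun z : ℝ × ℝ => (ψ z.1 z.2).2) (strip ε c d) z).comp
        (mfderivWithin 𝓘(ℝ, ℝ) 𝓘(ℝ, ℝ × ℝ) (fun s : ℝ => ((z.1, s) : ℝ × ℝ)) (Icc c d) z.2) :=
    mfderivWithin_comp z.2 (hσ.mdifferentiableOn (by simp) _ hz)
      h3.differentiableWithinAt.mdifferentiableWithinAt (fun s hs => ⟨hz.1, hs⟩)
      (uniqueDiffOn_Icc hcd z.2 hz.2).uniqueMDiffWithinAt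
  have h5 : (mfderivWithin 𝓘(ℝ, ℝ) 𝓘(ℝ, ℝ × ℝ) (fun s : ℝ => ((z.1, s) : ℝ × ℝ)) (Icc c d) z.2 :
      ℝ →L[ℝ] ℝ × ℝ) 1 = (0, 1) := by
    rw [mfderivWithin_eq_fderivWithin]
    exact h3.derivWithin (uniqueDiffOn_Icc hcd z.2 hz.2)
  have h6 : (velocityWithin E (ψ z.1) (Icc c d) z.2).2 =
      (mfderivWithin 𝓘(ℝ, ℝ × ℝ) 𝓘(ℝ, E) (fun z : ℝ × ℝ => (ψ z.1 z.2).2) (strip ε c d) z :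
        ℝ × ℝ →L[ℝ] E) (0, 1) := by
    refine (congrArg (fun f : ℝ →L[ℝ] E => f 1) h4).trans ?_
    rw [← h5]
    rfl
  exact congrArg (fun v : TangentSpace 𝓘(ℝ, E) (ψ z.1 z.2).2 =>
    (⟨(ψ z.1 z.2).2, v⟩ : TangentBundle 𝓘(ℝ, E) M)) h6

end Variation

/-! ### Regularity of `L` along a variation. -/

namespace Spacetime

variable {E : Type*} [NormedAddCommGroup E] [NormedSpace ℝ E]
  {M : Type*} [TopologicalSpace M] [ChartedSpace E M] [IsManifold 𝓘(ℝ, E) ∞ M]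
  (S : Spacetime E M) {ψ : ℝ → ℝ → ℝ × M} {ε c d : ℝ}

/-- The Finsler norm of the spatial velocity of `ψ r` on `[c, d]`. -/
noncomputable def spatialSpeed (ψ : ℝ → ℝ → ℝ × M) (c d : ℝ) (z : ℝ × ℝ) : ℝ :=
  S.F.toFun (ψ z.1 z.2).2 (velocityWithin E (ψ z.1) (Icc c d) z.2).2

theorem continuousOn_spatialSpeed (h : SmoothStrip E ψ ε c d) (hcd : c < d) :
    ContinuousOn (S.spatialSpeed ψ c d) (strip ε c d) :=
  S.F.continuous_toFun.comp_continuousOn (h.contMDiffOn_velocity_snd hcd).continuousOn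

theorem contDiffOn_spatialSpeed (h : SmoothStrip E ψ ε c d) (hcd : c < d)
    (hv : ∀ z ∈ strip ε c d, (velocityWithin E (ψ z.1) (Icc c d) z.2).2 ≠ 0) :
    ContDiffOn ℝ ∞ (S.spatialSpeed ψ c d) (strip ε c d) :=
  contMDiffOn_iff_contDiffOn.1
    (S.F.smooth_off_zero.comp (h.contMDiffOn_velocity_snd hcd) fun z hz => hv z hz)

theorem contDiffOn_lapse (h : SmoothStrip E ψ ε c d) :
    ContDiffOn ℝ ∞ (fun z : ℝ × ℝ => S.lapse (ψ z.1 z.2).2) (strip ε c d) :=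
  contMDiffOn_iff_contDiffOn.1 (S.lapse_smooth.comp_contMDiffOn (smoothStrip_iff.1 h).2)

/-- The integrand of the energy of `ψ r` on `[c, d]`. -/
noncomputable def lagrangian (ψ : ℝ → ℝ → ℝ × M) (c d : ℝ) (z : ℝ × ℝ) : ℝ :=
  S.L (ψ z.1 z.2) (velocityWithin E (ψ z.1) (Icc c d) z.2)

theorem lagrangian_eq (z : ℝ × ℝ) : S.lagrangian ψ c d z =
    -S.lapse (ψ z.1 z.2).2 * (velocityWithin E (ψ z.1) (Icc c d) z.2).1 ^ 2 +
      S.spatialSpeed ψ c d z ^ 2 := rfl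

theorem continuousOn_lagrangian (h : SmoothStrip E ψ ε c d) (hcd : c < d) :
    ContinuousOn (S.lagrangian ψ c d) (strip ε c d) :=
  ((S.contDiffOn_lapse h).continuousOn.neg.mul
    ((h.contDiffOn_velocity_fst hcd).continuousOn.pow 2)).add
      ((S.continuousOn_spatialSpeed h hcd).pow 2)

/-- `F²` need not be smooth at zero vectors. Compactness keeps the spatial velocity away from zero
on a thinner strip. -/
theorem exists_contDiffOn_lagrangian (hε : 0 < ε) (h : SmoothStrip E ψ ε c d) (hcd : c < d)
    (hv : ∀ s ∈ Icc c d, (velocityWithin E (ψ 0) (Icc c d) s).2 ≠ 0) :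
    ∃ δ ∈ Ioc 0 ε, ContDiffOn ℝ ∞ (S.lagrangian ψ c d) (strip δ c d) := by
  obtain ⟨δ, hδ, hpos⟩ := exists_strip_pos hε (S.continuousOn_spatialSpeed h hcd)
    fun s hs => S.F.pos _ _ (hv s hs)
  have h' := h.mono hδ.2 le_rfl le_rfl
  refine ⟨δ, hδ, ((S.contDiffOn_lapse h').neg.mul ((h'.contDiffOn_velocity_fst hcd).pow 2)).add
    ((S.contDiffOn_spatialSpeed h' hcd fun z hz h0 => ?_).pow 2)⟩
  have := hpos z.1 hz.1 z.2 hz.2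
  rw [spatialSpeed] at this
  simp only at this
  rw [h0, F_zero] at this
  exact lt_irrefl _ this

end Spacetime

theorem IsProperVariation.of_smoothStrip {E : Type*} [NormedAddCommGroup E] [NormedSpace ℝ E]
    {M : Type*} [TopologicalSpace M] [ChartedSpace E M] {γ : ℝ → ℝ × M} {a b ε : ℝ}
    {ψ : ℝ → ℝ → ℝ × M} (hab : a < b) (hε : 0 < ε) (base : ∀ s ∈ Icc a b, ψ 0 s = γ s)
    (hl : ∀ w ∈ Ioo (-ε) ε, ψ w a = γ a) (hr : ∀ w ∈ Ioo (-ε) ε, ψ w b = γ b)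
    (h : PiecewiseOn (SmoothStrip E ψ ε) a b) : IsProperVariation E γ a b ε ψ where
  eps_pos := hε
  continuousOn := by
    refine (h.induct (Q := fun c d => c ≤ d ∧
      ContinuousOn (fun z : ℝ × ℝ => ψ z.1 z.2) (Ioo (-ε) ε ×ˢ Icc c d)) hab ?_ ?_).2
    · exact fun c d _ hcd _ h => ⟨hcd.le, h.continuousOn⟩
    · exact fun c d h1 h2 _ h3 h4 =>
        ⟨h1.le.trans h2.le, continuousOn_prod_Icc_union h1.le h2.le h3.2 h4.2⟩
  base := base
  isCurve w hw := (isCurve_iff hab).2 (h.mono fun c d _ _ _ h => h.slice hw)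
  left_end := hl
  right_end := hr
  smooth := h

/-! ### Time shifts, and the case of a timelike piece. -/

namespace Spacetime

variable {E : Type*} [NormedAddCommGroup E] [NormedSpace ℝ E]
  {M : Type*} [TopologicalSpace M] [ChartedSpace E M] [IsManifold 𝓘(ℝ, E) ∞ M]
  (S : Spacetime E M) {ψ : ℝ → ℝ → ℝ × M} {γ : ℝ → ℝ × M} {ε a b c d : ℝ} {h h' : ℝ → ℝ}

/-- The curve `γ` on `[a, b]` has a proper variation through timelike future-pointing curves. -/
def HasTimelikeVariation (γ : ℝ → ℝ × M) (a b : ℝ) : Prop :=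
  ∃ (ε : ℝ) (ψ : ℝ → ℝ → ℝ × M), IsProperVariation E γ a b ε ψ ∧
    ∀ w ∈ Ioo (-ε) ε, w ≠ 0 → PiecewiseOn (PieceSat E S.FutureTimelike (ψ w)) a b

theorem pieceSat_variation (hψ : SmoothStrip E ψ ε c d) (hcd : c < d)
    (hh : ContDiffOn ℝ ∞ h (Icc c d))
    (hh' : ∀ s ∈ Icc c d, HasDerivWithinAt h (h' s) (Icc c d) s) {r : ℝ} (hr : r ∈ Ioo (-ε) ε)
    (hneg : ∀ s ∈ Icc c d, -S.lapse (ψ r s).2 *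
      ((velocityWithin E (ψ r) (Icc c d) s).1 + r * h' s) ^ 2 +
        S.spatialSpeed ψ c d (r, s) ^ 2 < 0)
    (hpos : ∀ s ∈ Icc c d, 0 < (velocityWithin E (ψ r) (Icc c d) s).1 + r * h' s) :
    PieceSat E S.FutureTimelike (fun s => ((ψ r s).1 + r * h s, (ψ r s).2)) c d := by
  have hsl := hψ.slice hr
  have hsl' := contMDiffOn_curve_iff.1 hsl
  refine ⟨contMDiffOn_curve_iff.2 ⟨hsl'.1.add (contDiffOn_const.mul hh), hsl'.2⟩,
    fun s hs => ?_⟩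
  rw [velocityWithin_add hsl ((hh' s hs).const_mul r) hs (uniqueDiffOn_Icc hcd s hs)]
  exact ⟨hneg s hs, hpos s hs⟩

/-- Timelikeness is needed only for small `r > 0`: the substitution `r = w²` is smooth and makes
both signs of `w` admissible. -/
theorem hasTimelikeVariation_of_family (hab : a < b) (hψ : IsProperVariation E γ a b ε ψ)
    (ha : h a = 0) (hb : h b = 0)
    (hh : PiecewiseOn (fun c d => ContDiffOn ℝ ∞ h (Icc c d)) a b)
    (hQ : ∃ δ > 0, ∀ r ∈ Ioo 0 δ, PiecewiseOn (PieceSat E S.FutureTimelike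
      (fun s => ((ψ r s).1 + r * h s, (ψ r s).2))) a b) :
    S.HasTimelikeVariation γ a b := by
  obtain ⟨δ, hδ, hQ⟩ := hQ
  -- The bound `1` gives `w² ≤ |w|`, so `w²` stays in the parameter range.
  have hη : 0 < min 1 (min ε δ) := lt_min one_pos (lt_min hψ.eps_pos hδ)
  set η := min 1 (min ε δ) with hηdef
  have hsq : ∀ w ∈ Ioo (-η) η, w ^ 2 < η := by
    intro w hw
    have h1 : |w| < η := abs_lt.2 hw
    have h2 : |w| ≤ 1 := h1.le.trans (min_le_left _ _)
    calc w ^ 2 = |w| * |w| := by rw [← sq, sq_abs]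
      _ ≤ |w| * 1 := by gcongr
      _ < η := by rwa [mul_one]
  have hηε : η ≤ ε := (min_le_right _ _).trans (min_le_left _ _)
  have hηδ : η ≤ δ := (min_le_right _ _).trans (min_le_right _ _)
  have hmem : ∀ w ∈ Ioo (-η) η, w ^ 2 ∈ Ioo (-ε) ε := fun w hw =>
    ⟨by linarith [sq_nonneg w, hψ.eps_pos], (hsq w hw).trans_le hηε⟩
  refine ⟨η, fun w s => ((ψ (w ^ 2) s).1 + w ^ 2 * h s, (ψ (w ^ 2) s).2), ?_, ?_⟩
  · refine IsProperVariation.of_smoothStrip hab hη ?_ ?_ ?_ ?_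
    · intro s hs
      simpa using hψ.base s hs
    · intro w hw
      simpa [ha] using hψ.left_end _ (hmem w hw)
    · intro w hw
      simpa [hb] using hψ.right_end _ (hmem w hw)
    · have h1 : PiecewiseOn (SmoothStrip E ψ ε) a b := hψ.smooth
      refine (h1.and (hereditary_smoothStrip ψ ε)
        (fun _ _ _ _ h h1 _ h3 => h.mono (Icc_subset_Icc h1 h3)) hh).mono ?_
      rintro c d - - - ⟨h2, h3⟩
      have h4 := h2.comp (ε' := η) (c' := c) (d' := d) (g := fun z => (z.1 ^ 2, z.2))
        (by fun_prop) fun z hz => ⟨hmem z.1 hz.1, hz.2⟩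
      rw [contMDiffOn_prod_iff, contMDiffOn_iff_contDiffOn] at h4
      have h5 : ContDiffOn ℝ ∞ (fun z : ℝ × ℝ => h z.2) (strip η c d) :=
        h3.comp contDiffOn_snd fun z hz => hz.2
      have h6 : ContDiffOn ℝ ∞ (fun z : ℝ × ℝ => z.1 ^ 2) (strip η c d) := by fun_prop
      exact smoothStrip_iff.2 ⟨h4.1.add (h6.mul h5), h4.2⟩
  · intro w hw hw0
    exact hQ (w ^ 2) ⟨by positivity, (hsq w hw).trans_le hηδ⟩

theorem exists_pieceSat_timelike (hcd : c < d) (hγ : PieceSat E S.FutureCausal γ c d)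
    {s₀ : ℝ} (hs₀ : s₀ ∈ Icc c d)
    (hneg : S.L (γ s₀) (velocityWithin E γ (Icc c d) s₀) < 0) :
    ∃ c' d', c ≤ c' ∧ c' < d' ∧ d' ≤ d ∧ PieceSat E S.FutureTimelike γ c' d' := by
  have hψ := smoothStrip_const hγ.1 1
  have h0 : (0 : ℝ) ∈ Ioo (-1 : ℝ) 1 := by norm_num
  have hc := continuousOn_slice (S.continuousOn_lagrangian hψ hcd) h0
  have hev : ∀ᶠ s in 𝓝[Icc c d] s₀, S.lagrangian (fun _ => γ) c d (0, s) < 0 :=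
    (hc s₀ hs₀).eventually (gt_mem_nhds hneg)
  obtain ⟨η, hη, hball⟩ := Metric.mem_nhdsWithin_iff.1 hev
  have key : ∀ c' d', c ≤ c' → c' < d' → d' ≤ d → (∀ s ∈ Icc c' d', |s - s₀| < η) →
      PieceSat E S.FutureTimelike γ c' d' := by
    intro c' d' h1 h2 h3 h4
    have hsub := Icc_subset_Icc h1 h3
    refine ⟨hγ.1.mono hsub, fun s hs => ?_⟩
    rw [velocityWithin_eq hγ.1 (hsub hs) (uniqueDiffOn_Icc h2 s hs)
      (Filter.mem_of_superset self_mem_nhdsWithin hsub)]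
    exact ⟨hball ⟨h4 s hs, hsub hs⟩, (hγ.2 s (hsub hs)).2⟩
  rcases hs₀.2.lt_or_eq with h1 | h1
  · have h2 : s₀ < min d (s₀ + η / 2) := lt_min h1 (by linarith)
    refine ⟨s₀, min d (s₀ + η / 2), hs₀.1, h2, min_le_left _ _,
      key _ _ hs₀.1 h2 (min_le_left _ _) fun s hs => ?_⟩
    have := hs.2.trans (min_le_right _ _)
    rw [abs_lt]; constructor <;> linarith [hs.1]
  · have h2 : max c (s₀ - η / 2) < s₀ := max_lt (h1 ▸ hcd) (by linarith)
    refine ⟨max c (s₀ - η / 2), s₀, le_max_left _ _, h2, hs₀.2,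
      key _ _ (le_max_left _ _) h2 hs₀.2 fun s hs => ?_⟩
    have := (le_max_right _ _).trans hs.1
    rw [abs_lt]; constructor <;> linarith [hs.2]

theorem futureTimelike_add {p : ℝ × M} {v : Tan E p}
    (hv : S.FutureCausal p v) {k : ℝ} (hk : 0 < k) :
    -S.lapse p.2 * (v.1 + k) ^ 2 + S.F.toFun p.2 v.2 ^ 2 < 0 ∧ 0 < v.1 + k := by
  obtain ⟨h1, h2⟩ := hv
  refine ⟨?_, by linarith⟩
  rw [L] at h1
  nlinarith [S.lapse_pos p.2, mul_pos (S.lapse_pos p.2) (mul_pos h2 hk),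
    mul_pos (S.lapse_pos p.2) (mul_pos hk hk)]

/-- Time is gained at unit rate outside `[c, d]`, which any causal velocity tolerates, and is paid
back on `[c, d]`, where timelikeness is stable for small `r`. -/
theorem hasTimelikeVariation_of_timelike_piece (hac : a ≤ c) (hcd : c < d) (hdb : d ≤ b)
    (hγ : PiecewiseOn (PieceSat E S.FutureCausal γ) a b)
    (hcd' : PieceSat E S.FutureTimelike γ c d) : S.HasTimelikeVariation γ a b := by
  have hab : a < b := hac.trans_lt (hcd.trans_le hdb)
  -- The slope that takes `h` from `c - a` at `c` to `d - b` at `d`, so that unit slope afterwards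
  -- ends at zero.
  set m : ℝ := ((c - a) + (b - d)) / (d - c) with hm
  have hmdc : m * (d - c) = (c - a) + (b - d) := div_mul_cancel₀ _ (sub_pos.2 hcd).ne'
  set h : ℝ → ℝ := fun s => if s ≤ c then s - a else if s ≤ d then (c - a) - m * (s - c) else s - b
    with hh
  have e1 : ∀ x y, y ≤ c → EqOn h (fun s => s - a) (Icc x y) := fun x y hy s hs =>
    if_pos (hs.2.trans hy)
  have e2 : EqOn h (fun s => (c - a) - m * (s - c)) (Icc c d) := by
    intro s hs
    rcases hs.1.eq_or_lt with h1 | h1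
    · subst h1; simp [hh]
    · simp [hh, not_le.2 h1, hs.2]
  have e3 : ∀ x y, d ≤ x → EqOn h (fun s => s - b) (Icc x y) := by
    intro x y hx s hs
    have h0 : ¬ s ≤ c := not_le.2 (hcd.trans_le (hx.trans hs.1))
    rcases (hx.trans hs.1).eq_or_lt with h1 | h1
    · subst h1
      simp only [hh, h0, if_false, le_refl, if_true]
      linarith
    · simp [hh, h0, not_le.2 h1]
  have g1 : ∀ x y, y ≤ c → ∀ s ∈ Icc x y, HasDerivWithinAt h 1 (Icc x y) s :=
    fun x y hy s hs => ((hasDerivWithinAt_id s _).sub_const a).congr (e1 x y hy) (e1 x y hy hs)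
  have g2 : ∀ s ∈ Icc c d, HasDerivWithinAt h (-m) (Icc c d) s := fun s hs =>
    ((((hasDerivWithinAt_id s _).sub_const c).const_mul m).const_sub (c - a)).congr_deriv
      (by simp) |>.congr e2 (e2 hs)
  have g3 : ∀ x y, d ≤ x → ∀ s ∈ Icc x y, HasDerivWithinAt h 1 (Icc x y) s :=
    fun x y hy s hs => ((hasDerivWithinAt_id s _).sub_const b).congr (e3 x y hy) (e3 x y hy hs)
  have s1 : ∀ x y, y ≤ c → ContDiffOn ℝ ∞ h (Icc x y) := fun x y hy =>
    ContDiffOn.congr (by fun_prop) (e1 x y hy)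
  have s2 : ContDiffOn ℝ ∞ h (Icc c d) := ContDiffOn.congr (by fun_prop) e2
  have s3 : ∀ x y, d ≤ x → ContDiffOn ℝ ∞ h (Icc x y) := fun x y hy =>
    ContDiffOn.congr (by fun_prop) (e3 x y hy)
  have hsm : PiecewiseOn (SmoothStrip E (fun _ => γ) 1) a b :=
    hγ.mono fun x y _ _ _ h => smoothStrip_const h.1 1
  have hψ : IsProperVariation E γ a b 1 fun _ => γ :=
    IsProperVariation.of_smoothStrip hab one_pos (fun _ _ => rfl) (fun _ _ => rfl)
      (fun _ _ => rfl) hsm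
  have hγ1 := hγ.restrict (hereditary_pieceSat _ _) le_rfl hac (hcd.le.trans hdb)
  have hγ3 := hγ.restrict (hereditary_pieceSat _ _) (hac.trans hcd.le) hdb le_rfl
  refine S.hasTimelikeVariation_of_family (h := h) hab hψ ?_ ?_ ?_ ?_
  · simp [hh, hac]
  · simpa using e3 d b le_rfl ⟨hdb, le_rfl⟩
  · exact ((hγ1.mono fun x y _ _ hy _ => s1 x y hy).snoc hcd s2).trans
      (hγ3.mono fun x y hx _ _ _ => s3 x y hx)
  have hst := smoothStrip_const hcd'.1 1
  have c1 : ContinuousOn (fun z : ℝ × ℝ => (velocityWithin E γ (Icc c d) z.2).1 + z.1 * -m)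
      (strip 1 c d) :=
    (hst.contDiffOn_velocity_fst hcd).continuousOn.add (by fun_prop)
  have c2 : ContinuousOn (fun z : ℝ × ℝ => -(-S.lapse (γ z.2).2 *
      ((velocityWithin E γ (Icc c d) z.2).1 + z.1 * -m) ^ 2 +
        S.spatialSpeed (fun _ => γ) c d z ^ 2)) (strip 1 c d) :=
    (((S.contDiffOn_lapse hst).continuousOn.neg.mul (c1.pow 2)).add
      ((S.continuousOn_spatialSpeed hst hcd).pow 2)).neg
  obtain ⟨δ₁, hδ₁, h1⟩ := exists_strip_pos one_pos c1 fun s hs => by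
    simpa using (hcd'.2 s hs).2
  obtain ⟨δ₂, hδ₂, h2⟩ := exists_strip_pos one_pos c2 fun s hs => by
    have := (hcd'.2 s hs).1
    rw [L] at this
    simp only [zero_mul, add_zero]
    exact neg_pos.2 this
  refine ⟨min δ₁ δ₂, lt_min hδ₁.1 hδ₂.1, fun r hr => ?_⟩
  have hr1 : r ∈ Ioo (-δ₁) δ₁ :=
    ⟨by linarith [hr.1, hδ₁.1], hr.2.trans_le (min_le_left _ _)⟩
  have hr2 : r ∈ Ioo (-δ₂) δ₂ :=
    ⟨by linarith [hr.1, hδ₂.1], hr.2.trans_le (min_le_right _ _)⟩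
  have hr0 : r ∈ Ioo (-1 : ℝ) 1 := ⟨by linarith [hr.1], hr1.2.trans_le hδ₁.2⟩
  refine ((hγ1.mono ?_).snoc hcd ?_).trans (hγ3.mono ?_)
  · intro x y _ hxy hy hp
    have := fun s hs => S.futureTimelike_add (hp.2 s hs) (k := r * 1)
      (by linarith [hr.1])
    exact S.pieceSat_variation (smoothStrip_const hp.1 1) hxy (s1 x y hy) (g1 x y hy) hr0
      (fun s hs => (this s hs).1) fun s hs => (this s hs).2
  · exact S.pieceSat_variation hst hcd s2 g2 hr0
      (fun s hs => neg_pos.1 (h2 r hr2 s hs)) fun s hs => h1 r hr1 s hs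
  · intro x y hx hxy _ hp
    have := fun s hs => S.futureTimelike_add (hp.2 s hs) (k := r * 1)
      (by linarith [hr.1])
    exact S.pieceSat_variation (smoothStrip_const hp.1 1) hxy (s3 x y hx) (g3 x y hx) hr0
      (fun s hs => (this s hs).1) fun s hs => (this s hs).2

end Spacetime

/-! ### Parameter changes and concatenation of curves. -/

section Reparametrization

variable {E : Type*} [NormedAddCommGroup E] [NormedSpace ℝ E]
  {M : Type*} [TopologicalSpace M] [ChartedSpace E M]
  {P Q : (p : ℝ × M) → Tan E p → Prop} {γ γ₁ γ₂ : ℝ → ℝ × M} {a b c d c' d' : ℝ}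

theorem PieceSat.comp {φ φ' : ℝ → ℝ} (hγ : PieceSat E P γ c' d') (hcd : c < d)
    (hφ : ContDiffOn ℝ ∞ φ (Icc c d))
    (hφ' : ∀ s ∈ Icc c d, HasDerivWithinAt φ (φ' s) (Icc c d) s)
    (hmaps : MapsTo φ (Icc c d) (Icc c' d'))
    (hPQ : ∀ s ∈ Icc c d, ∀ v, P (γ (φ s)) v → Q (γ (φ s)) (φ' s • v)) :
    PieceSat E Q (γ ∘ φ) c d := by
  refine ⟨hγ.1.comp hφ.contMDiffOn hmaps, fun s hs => ?_⟩
  rw [velocityWithin_comp hγ.1 (hφ' s hs) hmaps hs (uniqueDiffOn_Icc hcd s hs)]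
  exact hPQ s hs _ (hγ.2 _ (hmaps hs))

theorem exists_concat {a b c d : ℝ} (hcd : c ≤ d) (heq : γ₁ b = γ₂ c) :
    ∃ γ : ℝ → ℝ × M, EqOn γ γ₁ (Icc a b) ∧ γ (b + (d - c)) = γ₂ d ∧
      ∀ P : (p : ℝ × M) → Tan E p → Prop, PiecewiseOn (PieceSat E P γ₂) c d →
        PiecewiseOn (PieceSat E P γ) b (b + (d - c)) := by
  set γ : ℝ → ℝ × M := fun s => if s ≤ b then γ₁ s else γ₂ (s + (c - b)) with hγ
  have e2 : ∀ s, b ≤ s → γ s = γ₂ (s + (c - b)) := by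
    intro s hs
    rcases hs.eq_or_lt with h | h
    · subst h; simp [hγ, heq]
    · simp [hγ, not_le.2 h]
  refine ⟨γ, fun s hs => if_pos hs.2, ?_, fun P hP => ?_⟩
  · rw [e2 _ (by linarith)]
    congr 1
    ring
  · have h1 : b + (c - b) = c := by ring
    have h2 : b + (d - c) + (c - b) = d := by ring
    have h3 := PiecewiseOn.comp (P := PieceSat E P γ₂) (u := fun s => s + (c - b))
      (a := b) (b := b + (d - c)) (by linarith) (by fun_prop)
      (fun x _ y _ hxy => by simpa using hxy) (by simpa only [h1, h2] using hP)
    refine h3.mono fun x y hx hxy _ hp => ?_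
    refine PieceSat.congr (γ := γ₂ ∘ fun s => s + (c - b)) ?_ fun s hs => e2 s (hx.trans hs.1)
    refine hp.comp (φ' := fun _ => 1) hxy (by fun_prop)
      (fun s _ => (hasDerivWithinAt_id s _).add_const _) (fun s hs => ?_) fun s _ v hv => ?_
    · exact ⟨by linarith [hs.1], by linarith [hs.2]⟩
    · rwa [one_smul]

theorem velocitiesSatisfy_and_iff : VelocitiesSatisfy E P γ a b ∧ VelocitiesSatisfy E Q γ a b ↔
    VelocitiesSatisfy E (fun p v => P p v ∧ Q p v) γ a b :=
  ⟨fun h => ⟨fun s hs => ⟨h.1.1 s hs, h.2.1 s hs⟩, fun s hs => ⟨h.1.2 s hs, h.2.2 s hs⟩⟩,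
    fun h => ⟨⟨fun s hs => (h.1 s hs).1, fun s hs => (h.2 s hs).1⟩,
      ⟨fun s hs => (h.1 s hs).2, fun s hs => (h.2 s hs).2⟩⟩⟩

end Reparametrization

/-! ### Chronological and causal relations: push-up and closures. -/

namespace Spacetime

variable {E : Type*} [NormedAddCommGroup E] [NormedSpace ℝ E]
  {M : Type*} [TopologicalSpace M] [ChartedSpace E M] [IsManifold 𝓘(ℝ, E) ∞ M]
  (S : Spacetime E M) {γ : ℝ → ℝ × M} {a b : ℝ} {p q z : ℝ × M}

theorem isTimelikeCurve_and_isFuturePointing_iff (hab : a < b) :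
    S.IsTimelikeCurve γ a b ∧ S.IsFuturePointing γ a b ↔
      PiecewiseOn (PieceSat E S.FutureTimelike γ) a b := by
  rw [← isCurve_and_velocitiesSatisfy_iff hab, IsTimelikeCurve, IsFuturePointing, and_assoc,
    velocitiesSatisfy_and_iff]
  simp only [timelike_and_future_iff]

theorem isCausalCurve_and_isFuturePointing_iff (hab : a < b) :
    S.IsCausalCurve γ a b ∧ S.IsFuturePointing γ a b ↔
      PiecewiseOn (PieceSat E S.FutureCausal γ) a b := by
  rw [← isCurve_and_velocitiesSatisfy_iff hab, IsCausalCurve, IsFuturePointing, and_assoc,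
    velocitiesSatisfy_and_iff]
  simp only [causal_and_future_iff]

theorem chron_iff : S.Chron p q ↔ ∃ (a b : ℝ) (γ : ℝ → ℝ × M), a < b ∧
    PiecewiseOn (PieceSat E S.FutureTimelike γ) a b ∧ γ a = p ∧ γ b = q := by
  refine exists_congr fun a => exists_congr fun b => exists_congr fun γ =>
    and_congr_right fun hab => ?_
  rw [← S.isTimelikeCurve_and_isFuturePointing_iff hab, and_assoc]

theorem causalRel_iff : S.CausalRel p q ↔ p = q ∨ ∃ (a b : ℝ) (γ : ℝ → ℝ × M), a < b ∧
    PiecewiseOn (PieceSat E S.FutureCausal γ) a b ∧ γ a = p ∧ γ b = q := by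
  refine or_congr_right (exists_congr fun a => exists_congr fun b => exists_congr fun γ =>
    and_congr_right fun hab => ?_)
  rw [← S.isCausalCurve_and_isFuturePointing_iff hab, and_assoc]

theorem HasTimelikeVariation.chron (hab : a < b) (h : S.HasTimelikeVariation γ a b) :
    S.Chron (γ a) (γ b) := by
  obtain ⟨ε, ψ, hψ, h⟩ := h
  have hε := hψ.eps_pos
  have hw : ε / 2 ∈ Ioo (-ε) ε := ⟨by linarith, by linarith⟩
  exact S.chron_iff.2 ⟨a, b, ψ (ε / 2), hab, h _ hw (by positivity), hψ.left_end _ hw,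
    hψ.right_end _ hw⟩

theorem chron_of_causalRel_of_chron (h1 : S.CausalRel p q) (h2 : S.Chron q z) : S.Chron p z := by
  rcases S.causalRel_iff.1 h1 with rfl | ⟨a, b, γ₁, hab, hγ₁, rfl, rfl⟩
  · exact h2
  obtain ⟨c, d, γ₂, hcd, hγ₂, hc, rfl⟩ := S.chron_iff.1 h2
  obtain ⟨γ, e1, e2, e3⟩ := exists_concat (E := E) (a := a) hcd.le hc.symm
  have h3 := e3 _ hγ₂
  have hlt : b < b + (d - c) := by linarith
  -- Any smooth piece of the timelike half serves as the timelike piece of the concatenation.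
  obtain ⟨x, y, hx, hy, hxy, hp⟩ := h3.right ⟨le_rfl, hlt⟩
  have h4 := (hγ₁.mono fun x y hx _ hy h => h.congr (e1.mono (Icc_subset_Icc hx hy))).trans
    (h3.mono fun x y _ _ _ h => h.imp fun _ _ h => h.futureCausal)
  have := (S.hasTimelikeVariation_of_timelike_piece (hab.le.trans hx) (hxy.1.trans_lt hxy.2) hy
    h4 hp).chron S (hab.trans hlt)
  rwa [e1 ⟨le_rfl, hab.le⟩, e2] at this

theorem chron_of_chron_of_causalRel (h1 : S.Chron p q) (h2 : S.CausalRel q z) : S.Chron p z := by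
  rcases S.causalRel_iff.1 h2 with rfl | ⟨c, d, γ₂, hcd, hγ₂, hc, rfl⟩
  · exact h1
  obtain ⟨a, b, γ₁, hab, hγ₁, rfl, rfl⟩ := S.chron_iff.1 h1
  obtain ⟨γ, e1, e2, e3⟩ := exists_concat (E := E) (a := a) hcd.le hc.symm
  have hlt : b < b + (d - c) := by linarith
  have h3 := hγ₁.mono fun x y hx _ hy h => h.congr (e1.mono (Icc_subset_Icc hx hy))
  obtain ⟨x, y, hx, hy, hxy, hp⟩ := h3.right ⟨le_rfl, hab⟩
  have h4 := (h3.mono fun x y _ _ _ h => h.imp fun _ _ h => h.futureCausal).trans (e3 _ hγ₂)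
  have := (S.hasTimelikeVariation_of_timelike_piece hx (hxy.1.trans_lt hxy.2)
    (hy.trans hlt.le) h4 hp).chron S (hab.trans hlt)
  rwa [e1 ⟨le_rfl, hab.le⟩, e2] at this

theorem chron_vertical (x : M) {t t' : ℝ} (h : t < t') : S.Chron (t, x) (t', x) := by
  refine S.chron_iff.2 ⟨t, t', fun s => (s, x), h, PiecewiseOn.single h ⟨?_, ?_⟩, rfl, rfl⟩
  · exact contMDiffOn_curve_iff.2 ⟨contDiffOn_id, contMDiffOn_const⟩
  · intro s hs
    have h1 : velocityWithin E (fun s => (s, x)) (Icc t t') s = (1, 0) := by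
      refine Prod.ext ?_ ?_
      · exact derivWithin_id s _ (uniqueDiffOn_Icc h s hs)
      · have h2 : mfderivWithin 𝓘(ℝ, ℝ) 𝓘(ℝ, E) (fun _ : ℝ => x) (Icc t t') s = 0 :=
          mfderivWithin_const
        exact congrArg (fun f : ℝ →L[ℝ] E => f 1) h2
    rw [h1]
    refine ⟨?_, one_pos⟩
    simpa [L, F_zero] using S.lapse_pos x

theorem causalRel_of_chron (h : S.Chron p q) : S.CausalRel p q := by
  obtain ⟨a, b, γ, hab, hγ, h⟩ := S.chron_iff.1 h
  exact S.causalRel_iff.2 (Or.inr ⟨a, b, γ, hab,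
    hγ.mono fun _ _ _ _ _ h => h.imp fun _ _ h => h.futureCausal, h⟩)

theorem closure_causalFuture (p : ℝ × M) :
    closure (S.causalFuture p) = closure (S.chronFuture p) := by
  refine (closure_minimal (fun q hq => ?_) isClosed_closure).antisymm
    (closure_mono fun q hq => S.causalRel_of_chron hq)
  have h1 : Filter.Tendsto (fun t : ℝ => ((t, q.2) : ℝ × M)) (𝓝[>] q.1) (𝓝 q) :=
    ((continuous_id.prodMk continuous_const).tendsto' q.1 q rfl).mono_left nhdsWithin_le_nhds
  refine mem_closure_of_tendsto h1 ?_
  filter_upwards [self_mem_nhdsWithin] with t ht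
  exact S.chron_of_causalRel_of_chron hq (S.chron_vertical q.2 ht)

theorem closure_causalPast (p : ℝ × M) :
    closure (S.causalPast p) = closure (S.chronPast p) := by
  refine (closure_minimal (fun q hq => ?_) isClosed_closure).antisymm
    (closure_mono fun q hq => S.causalRel_of_chron hq)
  have h1 : Filter.Tendsto (fun t : ℝ => ((t, q.2) : ℝ × M)) (𝓝[<] q.1) (𝓝 q) :=
    ((continuous_id.prodMk continuous_const).tendsto' q.1 q rfl).mono_left nhdsWithin_le_nhds
  refine mem_closure_of_tendsto h1 ?_
  filter_upwards [self_mem_nhdsWithin] with t ht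
  exact S.chron_of_chron_of_causalRel (S.chron_vertical q.2 ht) hq

end Spacetime

/-! ### First variation of the energy at a unit lightlike curve. -/

namespace Spacetime

variable {E : Type*} [NormedAddCommGroup E] [NormedSpace ℝ E]
  {M : Type*} [TopologicalSpace M] [ChartedSpace E M] [IsManifold 𝓘(ℝ, E) ∞ M]
  (S : Spacetime E M) {ψ : ℝ → ℝ → ℝ × M} {γ : ℝ → ℝ × M} {ε a b c d : ℝ}

/-- The integrand of the energy of `ψ r` at the parameter `s`. -/
noncomputable def energyDensity (ψ : ℝ → ℝ → ℝ × M) (r s : ℝ) : ℝ :=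
  S.L (ψ r s) (velocityRight E (ψ r) s)

/-- The derivative of the energy density in the direction of the variation. -/
noncomputable def energyDensityDeriv (ψ : ℝ → ℝ → ℝ × M) (s : ℝ) : ℝ :=
  deriv (fun r => S.energyDensity ψ r s) 0

theorem energyDensity_eq (hψ : SmoothStrip E ψ ε c d) {r : ℝ} (hr : r ∈ Ioo (-ε) ε) :
    EqOn (S.energyDensity ψ r) (fun s => S.lagrangian ψ c d (r, s)) (Ico c d) := fun s hs => by
  rw [energyDensity, velocityRight_eq (hψ.slice hr) hs]
  rfl

theorem exists_lagrangian_deriv (hε : 0 < ε) (hψ : SmoothStrip E ψ ε c d) (hcd : c < d)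
    (h0 : PieceSat E S.UnitLightlike (ψ 0) c d) :
    ∃ δ ∈ Ioc 0 ε, ∃ g : ℝ × ℝ → ℝ, ContDiffOn ℝ ∞ (S.lagrangian ψ c d) (strip δ c d) ∧
      ContDiffOn ℝ ∞ g (strip δ c d) ∧
      (∀ r ∈ Ioo (-δ) δ, ∀ s ∈ Icc c d,
        HasDerivAt (fun r => S.lagrangian ψ c d (r, s)) (g (r, s)) r) ∧
      EqOn (S.energyDensityDeriv ψ) (fun s => g (0, s)) (Ico c d) := by
  obtain ⟨δ, hδ, hL⟩ := S.exists_contDiffOn_lagrangian hε hψ hcd fun s hs => (h0.2 s hs).1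
  obtain ⟨g, hg, hd⟩ := exists_deriv_fst hcd hL
  refine ⟨δ, hδ, g, hL, hg, hd, fun s hs => ?_⟩
  have hmem : (0 : ℝ) ∈ Ioo (-δ) δ := ⟨by linarith [hδ.1], hδ.1⟩
  have hmem' : (0 : ℝ) ∈ Ioo (-ε) ε := ⟨by linarith, hε⟩
  have : (fun r => S.energyDensity ψ r s) =ᶠ[𝓝 0] fun r => S.lagrangian ψ c d (r, s) := by
    filter_upwards [isOpen_Ioo.mem_nhds hmem'] with r hr using S.energyDensity_eq hψ hr hs
  rw [energyDensityDeriv, this.deriv_eq]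
  exact (hd 0 hmem s (Ico_subset_Icc_self hs)).deriv

theorem integral_congr_Ico {f g : ℝ → ℝ} (hcd : c < d) (h : EqOn f g (Ico c d)) :
    (IntervalIntegrable f volume c d ↔ IntervalIntegrable g volume c d) ∧
      ∫ s in c..d, f s = ∫ s in c..d, g s := by
  have hae : ∀ᵐ x ∂volume, x ∈ uIoc c d → f x = g x := by
    filter_upwards [Measure.ae_ne volume d] with x hx hxs
    rw [uIoc_of_le hcd.le] at hxs
    exact h ⟨hxs.1.le, hxs.2.lt_of_ne hx⟩
  exact ⟨intervalIntegrable_congr_ae ((ae_restrict_iff' measurableSet_uIoc).2 hae),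
    intervalIntegral.integral_congr_ae hae⟩

/-- Differentiation under the integral on each piece, then addition. The induction also carries
integrability for `r` near zero, without which the integrals could not be added. -/
theorem hasDerivAt_integral_energyDensity (hab : a < b) (hε : 0 < ε)
    (h : PiecewiseOn (fun c d => SmoothStrip E ψ ε c d ∧ PieceSat E S.UnitLightlike (ψ 0) c d)
      a b) :
    IntervalIntegrable (S.energyDensityDeriv ψ) volume a b ∧
    HasDerivAt (fun r => ∫ s in a..b, S.energyDensity ψ r s)
      (∫ s in a..b, S.energyDensityDeriv ψ s) 0 := by
  have := h.induct (Q := fun c d => IntervalIntegrable (S.energyDensityDeriv ψ) volume c d ∧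
    HasDerivAt (fun r => ∫ s in c..d, S.energyDensity ψ r s)
      (∫ s in c..d, S.energyDensityDeriv ψ s) 0 ∧
    ∀ᶠ r in 𝓝 0, IntervalIntegrable (S.energyDensity ψ r) volume c d) hab ?_ ?_
  · exact ⟨this.1, this.2.1⟩
  · rintro c d - hcd - ⟨hψ, h0⟩
    obtain ⟨δ, hδ, g, hL, hg, hd, hk⟩ := S.exists_lagrangian_deriv hε hψ hcd h0
    have hmem : (0 : ℝ) ∈ Ioo (-δ) δ := ⟨by linarith [hδ.1], hδ.1⟩
    have hK : ∀ r ∈ Ioo (-δ) δ,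
        EqOn (S.energyDensity ψ r) (fun s => S.lagrangian ψ c d (r, s)) (Ico c d) := fun r hr =>
      S.energyDensity_eq hψ ⟨by linarith [hr.1, hδ.2], hr.2.trans_le hδ.2⟩
    obtain ⟨h1, h2⟩ := integral_congr_Ico hcd hk
    refine ⟨h1.2 ((continuousOn_slice hg.continuousOn hmem).intervalIntegrable_of_Icc hcd.le),
      ?_, ?_⟩
    · rw [h2]
      refine (hasDerivAt_integral_strip hδ.1 hcd hL.continuousOn hg.continuousOn
        hd).congr_of_eventuallyEq ?_
      filter_upwards [isOpen_Ioo.mem_nhds hmem] with r hr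
      exact (integral_congr_Ico hcd (hK r hr)).2
    · filter_upwards [isOpen_Ioo.mem_nhds hmem] with r hr
      exact (integral_congr_Ico hcd (hK r hr)).1.2
        ((continuousOn_slice hL.continuousOn hr).intervalIntegrable_of_Icc hcd.le)
  · rintro c d - - - ⟨h1, h2, h3⟩ ⟨h4, h5, h6⟩
    refine ⟨h1.trans h4, ?_, ?_⟩
    · rw [← intervalIntegral.integral_add_adjacent_intervals h1 h4]
      refine (h2.add h5).congr_of_eventuallyEq ?_
      filter_upwards [h3, h6] with r h7 h8
      exact (intervalIntegral.integral_add_adjacent_intervals h7 h8).symm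
    · filter_upwards [h3, h6] with r h7 h8 using h7.trans h8

/-- After the shift `L` vanishes at `r = 0` and has `r`-derivative `g - 2Λτh' = g - 2h' = κ < 0`
there, by the normalization `Λτ = 1`. -/
theorem exists_pieceSat_variation {h h' : ℝ → ℝ} {κ δ : ℝ} {g : ℝ × ℝ → ℝ} (hε : 0 < ε)
    (hψ : SmoothStrip E ψ ε c d) (hcd : c < d) (h0 : PieceSat E S.UnitLightlike (ψ 0) c d)
    (hδ : δ ∈ Ioc 0 ε) (hL : ContDiffOn ℝ ∞ (S.lagrangian ψ c d) (strip δ c d))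
    (hg : ∀ r ∈ Ioo (-δ) δ, ∀ s ∈ Icc c d,
      HasDerivAt (fun r => S.lagrangian ψ c d (r, s)) (g (r, s)) r)
    (hh : ContDiffOn ℝ ∞ h (Icc c d)) (hh'c : ContDiffOn ℝ ∞ h' (Icc c d))
    (hh' : ∀ s ∈ Icc c d, HasDerivWithinAt h (h' s) (Icc c d) s)
    (hκ : κ < 0) (hgκ : ∀ s ∈ Icc c d, g (0, s) - 2 * h' s = κ) :
    ∃ η > 0, ∀ r ∈ Ioo 0 η,
      PieceSat E S.FutureTimelike (fun s => ((ψ r s).1 + r * h s, (ψ r s).2)) c d := by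
  have hψ' := hψ.mono hδ.2 le_rfl le_rfl
  have hmem : (0 : ℝ) ∈ Ioo (-δ) δ := ⟨by linarith [hδ.1], hδ.1⟩
  have hh2 : ContDiffOn ℝ ∞ (fun z : ℝ × ℝ => h' z.2) (strip δ c d) :=
    hh'c.comp contDiffOn_snd fun z hz => hz.2
  have hτ := hψ'.contDiffOn_velocity_fst hcd
  have h1s : ContDiffOn ℝ ∞ (fun z : ℝ × ℝ => z.1) (strip δ c d) := contDiffOn_fst
  -- Defined by `-Λ(τ + r h')² = -Λτ² - r W`, so the shifted value of `L` is `L - r W`.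
  set W : ℝ × ℝ → ℝ := fun z => S.lapse (ψ z.1 z.2).2 *
    (2 * (velocityWithin E (ψ z.1) (Icc c d) z.2).1 * h' z.2 + z.1 * h' z.2 ^ 2) with hW
  have hWc : ContDiffOn ℝ ∞ W (strip δ c d) :=
    (S.contDiffOn_lapse hψ').mul
      (((contDiffOn_const.mul hτ).mul hh2).add (h1s.mul (hh2.pow 2)))
  obtain ⟨W', -, hW'⟩ := exists_deriv_fst hcd hWc
  obtain ⟨N', hN'c, hN'⟩ := exists_deriv_fst hcd (hL.sub (h1s.mul hWc))
  have hN0 : ∀ s ∈ Icc c d, N' (0, s) = κ := by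
    intro s hs
    have e1 := (hg 0 hmem s hs).sub ((hasDerivAt_id (0 : ℝ)).mul (hW' 0 hmem s hs))
    rw [(hN' 0 hmem s hs).unique e1, ← hgκ s hs]
    have e2 := (h0.2 s hs).2.2
    have e3 : W (0, s) = 2 * h' s := by
      simp only [hW]
      linear_combination 2 * h' s * e2
    simp [e3]
  obtain ⟨η₁, hη₁, hneg⟩ := exists_strip_neg_of_deriv_neg
    (f := fun z => S.lagrangian ψ c d z - z.1 * W z) hδ.1 hN'c.continuousOn hN'
    (fun s hs => by
      have : S.lagrangian ψ c d (0, s) = 0 := (h0.2 s hs).2.1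
      simp [this]) fun s hs => by rw [hN0 s hs]; exact hκ
  obtain ⟨η₂, hη₂, hpos⟩ := exists_strip_pos hδ.1 (hτ.add (h1s.mul hh2)).continuousOn
    fun s hs => by
      have e1 := (h0.2 s hs).2.2
      have e2 := S.lapse_pos (ψ 0 s).2
      have : 0 < (velocityWithin E (ψ 0) (Icc c d) s).1 := by
        by_contra hc
        nlinarith
      simpa using this
  refine ⟨min η₁ η₂, lt_min hη₁.1 hη₂.1, fun r hr => ?_⟩
  have hr1 : r < η₁ := hr.2.trans_le (min_le_left _ _)
  have hr2 : r < η₂ := hr.2.trans_le (min_le_right _ _)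
  refine S.pieceSat_variation hψ hcd hh hh' ⟨by linarith [hr.1], ?_⟩ (fun s hs => ?_) fun s hs => ?_
  · linarith [hη₁.2, hδ.2]
  · have := hneg r ⟨hr.1, hr1⟩ s hs
    simp only [lagrangian_eq, hW] at this
    linarith
  · exact hpos r ⟨by linarith [hr.1, hη₂.1], hr2⟩ s hs

theorem hasTimelikeVariation_of_integral_neg (hab : a < b) (hψ : IsProperVariation E γ a b ε ψ)
    (hγ : PiecewiseOn (PieceSat E S.UnitLightlike γ) a b)
    (hneg : ∫ s in a..b, S.energyDensityDeriv ψ s < 0) : S.HasTimelikeVariation γ a b := by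
  have hsm : PiecewiseOn (SmoothStrip E ψ ε) a b := hψ.smooth
  have hp : PiecewiseOn (fun c d => SmoothStrip E ψ ε c d ∧
      PieceSat E S.UnitLightlike (ψ 0) c d) a b :=
    hsm.and (hereditary_smoothStrip ψ ε) (hereditary_pieceSat _ _)
      (hγ.mono fun c d hc _ hd h => h.congr fun s hs => hψ.base s ⟨hc.trans hs.1, hs.2.trans hd⟩)
  have hint := (S.hasDerivAt_integral_energyDensity hab hψ.eps_pos hp).1
  set κ := (∫ s in a..b, S.energyDensityDeriv ψ s) / (b - a) with hκdef
  have hκ : κ < 0 := div_neg_of_neg_of_pos hneg (sub_pos.2 hab)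
  -- Subtracting the mean makes the primitive `h` vanish at `b`; the factor `1/2` cancels the `2` in
  -- `k - 2h'`.
  set f : ℝ → ℝ := fun s => (1 / 2) * (S.energyDensityDeriv ψ s - κ) with hf
  have hfint : IntervalIntegrable f volume a b := (hint.sub intervalIntegrable_const).const_mul _
  set h : ℝ → ℝ := fun s => ∫ x in a..s, f x with hh
  have piece : ∀ c d, a ≤ c → c < d → d ≤ b → SmoothStrip E ψ ε c d ∧
      PieceSat E S.UnitLightlike (ψ 0) c d → ContDiffOn ℝ ∞ h (Icc c d) ∧
      ∃ η > 0, ∀ r ∈ Ioo 0 η,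
        PieceSat E S.FutureTimelike (fun s => ((ψ r s).1 + r * h s, (ψ r s).2)) c d := by
    rintro c d hac hcd hdb ⟨hψ', h0⟩
    obtain ⟨δ, hδ, g, hL, hg, hd, hk⟩ := S.exists_lagrangian_deriv hψ.eps_pos hψ' hcd h0
    have hmem : (0 : ℝ) ∈ Ioo (-δ) δ := ⟨by linarith [hδ.1], hδ.1⟩
    have hgs : ContDiffOn ℝ ∞ (fun s => (1 / 2) * (g (0, s) - κ)) (Icc c d) := by
      have hm : MapsTo (fun s : ℝ => ((0, s) : ℝ × ℝ)) (Icc c d) (strip δ c d) :=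
        fun s hs => ⟨hmem, hs⟩
      have := hg.comp (f := fun s : ℝ => ((0, s) : ℝ × ℝ)) (by fun_prop) hm
      exact contDiffOn_const.mul (this.sub contDiffOn_const)
    have hfac : IntervalIntegrable f volume a c := hfint.mono_set (by
      rw [uIcc_of_le hac, uIcc_of_le hab.le]
      exact Icc_subset_Icc le_rfl (hcd.le.trans hdb))
    obtain ⟨-, h2, h3⟩ := contDiffOn_integral_piece hcd hfac hgs fun s hs => by
      simp only [hf, hk hs]
    exact ⟨h2, S.exists_pieceSat_variation hψ.eps_pos hψ' hcd h0 hδ hL hd h2 hgs h3 hκ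
      fun s _ => by ring⟩
  refine S.hasTimelikeVariation_of_family (h := h) hab hψ ?_ ?_
    (hp.mono fun c d h1 h2 h3 h4 => (piece c d h1 h2 h3 h4).1) ?_
  · simp [hh]
  · simp only [hh, hf]
    rw [intervalIntegral.integral_const_mul, intervalIntegral.integral_sub hint
      intervalIntegrable_const, intervalIntegral.integral_const, smul_eq_mul, hκdef,
      mul_div_cancel₀ _ (sub_pos.2 hab).ne', sub_self, mul_zero]
  · refine hp.induct (Q := fun c d => ∃ δ > 0, ∀ r ∈ Ioo 0 δ,
      PiecewiseOn (PieceSat E S.FutureTimelike (fun s => ((ψ r s).1 + r * h s, (ψ r s).2))) c d)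
      hab ?_ ?_
    · intro c d h1 h2 h3 h4
      obtain ⟨η, hη, h5⟩ := (piece c d h1 h2 h3 h4).2
      exact ⟨η, hη, fun r hr => PiecewiseOn.single h2 (h5 r hr)⟩
    · rintro c d - - - ⟨η₁, h1, h2⟩ ⟨η₂, h3, h4⟩
      exact ⟨min η₁ η₂, lt_min h1 h3, fun r hr =>
        (h2 r ⟨hr.1, hr.2.trans_le (min_le_left _ _)⟩).trans
          (h4 r ⟨hr.1, hr.2.trans_le (min_le_right _ _)⟩)⟩

/-- The derivative of the energy exists and is half the integral of the density derivative, so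
noncriticality can only mean that this integral is nonzero. If it is positive, `r ↦ -r` reverses its
sign. -/
theorem hasTimelikeVariation_of_not_critical (hab : a < b) (hψ : IsProperVariation E γ a b ε ψ)
    (hγ : PiecewiseOn (PieceSat E S.UnitLightlike γ) a b)
    (hcrit : ¬ HasDerivAt (fun r => S.energy (ψ r) a b) 0 0) : S.HasTimelikeVariation γ a b := by
  have hsm : PiecewiseOn (SmoothStrip E ψ ε) a b := hψ.smooth
  have hp : PiecewiseOn (fun c d => SmoothStrip E ψ ε c d ∧
      PieceSat E S.UnitLightlike (ψ 0) c d) a b :=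
    hsm.and (hereditary_smoothStrip ψ ε) (hereditary_pieceSat _ _)
      (hγ.mono fun c d hc _ hd h => h.congr fun s hs => hψ.base s ⟨hc.trans hs.1, hs.2.trans hd⟩)
  have hd := ((S.hasDerivAt_integral_energyDensity hab hψ.eps_pos hp).2).const_mul (1 / 2)
  rcases lt_trichotomy (∫ s in a..b, S.energyDensityDeriv ψ s) 0 with h | h | h
  · exact S.hasTimelikeVariation_of_integral_neg hab hψ hγ h
  · rw [h, mul_zero] at hd
    exact absurd hd hcrit
  have hε := hψ.eps_pos
  have hneg : ∀ w ∈ Ioo (-ε) ε, -w ∈ Ioo (-ε) ε := fun w hw =>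
    ⟨neg_lt_neg hw.2, neg_lt.1 hw.1⟩
  refine S.hasTimelikeVariation_of_integral_neg (ψ := fun r => ψ (-r)) hab
    (IsProperVariation.of_smoothStrip hab hε ?_ ?_ ?_ ?_) hγ ?_
  · intro s hs
    simpa using hψ.base s hs
  · exact fun w hw => hψ.left_end _ (hneg w hw)
  · exact fun w hw => hψ.right_end _ (hneg w hw)
  · exact hsm.mono fun c d _ _ _ h => h.comp (g := fun z => (-z.1, z.2)) (by fun_prop)
      fun z hz => ⟨hneg z.1 hz.1, hz.2⟩
  · have : S.energyDensityDeriv (fun r => ψ (-r)) = fun s => -S.energyDensityDeriv ψ s := by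
      funext s
      have := deriv_comp_neg (fun r => S.energyDensity ψ r s) 0
      rw [neg_zero] at this
      exact this
    rw [this, intervalIntegral.integral_neg]
    exact neg_lt_zero.2 h

end Spacetime

/-! ### Piecewise smooth increasing parameter changes. -/

/-- `u` is smooth on `[c, d]` with positive derivative. -/
def PositivePiece (u : ℝ → ℝ) (c d : ℝ) : Prop :=
  ContDiffOn ℝ ∞ u (Icc c d) ∧
    ∃ u' : ℝ → ℝ, ∀ s ∈ Icc c d, HasDerivWithinAt u (u' s) (Icc c d) s ∧ 0 < u' s

section PositivePiece

variable {u : ℝ → ℝ} {a b c d : ℝ}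

theorem hereditary_positivePiece (u : ℝ → ℝ) : Hereditary (PositivePiece u) := by
  rintro c d c' d' ⟨h, u', hu'⟩ h1 h2 h3
  have hsub := Icc_subset_Icc h1 h3
  exact ⟨h.mono hsub, u', fun s hs => ⟨(hu' s (hsub hs)).1.mono hsub, (hu' s (hsub hs)).2⟩⟩

theorem PositivePiece.derivWithin_pos (h : PositivePiece u c d) (hcd : c < d) :
    ∀ s ∈ Icc c d, 0 < derivWithin u (Icc c d) s := by
  obtain ⟨u', hu'⟩ := h.2
  intro s hs
  rw [(hu' s hs).1.derivWithin (uniqueDiffOn_Icc hcd s hs)]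
  exact (hu' s hs).2

theorem PiecewiseOn.continuousOn_of_positivePiece (h : PiecewiseOn (PositivePiece u) a b)
    (hab : a < b) : ContinuousOn u (Icc a b) := by
  refine (h.induct (Q := fun c d => c ≤ d ∧ ContinuousOn u (Icc c d)) hab ?_ ?_).2
  · exact fun c d _ hcd _ h => ⟨hcd.le, h.1.continuousOn⟩
  · exact fun c d h1 h2 _ h3 h4 =>
      ⟨h1.le.trans h2.le, continuousOn_Icc_union h1.le h2.le h3.2 h4.2⟩

theorem PiecewiseOn.strictMonoOn_of_positivePiece (h : PiecewiseOn (PositivePiece u) a b)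
    (hab : a < b) : StrictMonoOn u (Icc a b) := by
  refine h.induct (Q := fun c d => StrictMonoOn u (Icc c d)) hab ?_ ?_
  · exact fun c d _ hcd _ h => strictMonoOn_of_derivWithin_pos h.1 (h.derivWithin_pos hcd)
  · intro c d h1 h2 _ h3 h4
    rw [← Icc_union_Icc_eq_Icc h1.le h2.le]
    exact h3.union h4 (isGreatest_Icc h1.le) (isLeast_Icc h2.le)

theorem PiecewiseOn.comp_and_positivePiece {P : ℝ → ℝ → Prop} (hP : Hereditary P)
    (hab : a < b) (hu : PiecewiseOn (PositivePiece u) a b) (h : PiecewiseOn P (u a) (u b)) :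
    PiecewiseOn (fun c d => P (u c) (u d) ∧ PositivePiece u c d) a b := by
  have hm := hu.strictMonoOn_of_positivePiece hab
  have h1 := PiecewiseOn.comp hab.le (hu.continuousOn_of_positivePiece hab) hm h
  -- Recording `[c, d] ⊆ [a, b]` in the predicate makes it hereditary: `u` is known to be monotone
  -- only on `[a, b]`.
  have h2 : PiecewiseOn (fun c d => (a ≤ c ∧ d ≤ b) ∧ P (u c) (u d)) a b :=
    h1.mono fun c d hc _ hd hP => ⟨⟨hc, hd⟩, hP⟩
  refine (h2.and ?_ (hereditary_positivePiece u) hu).mono fun _ _ _ _ _ h => ⟨h.1.2, h.2⟩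
  rintro c d c' d' ⟨⟨hac, hdb⟩, hcd⟩ h1 h2 h3
  have hac' := hac.trans h1
  have hdb' := h3.trans hdb
  have hc' : c' ∈ Icc a b := ⟨hac', h2.le.trans hdb'⟩
  have hd' : d' ∈ Icc a b := ⟨hac'.trans h2.le, hdb'⟩
  exact ⟨⟨hac', hdb'⟩, hP hcd (hm.monotoneOn ⟨hac, h1.trans hc'.2⟩ hc' h1) (hm hc' hd' h2)
    (hm.monotoneOn hd' ⟨hd'.1.trans h3, hdb⟩ h3)⟩

end PositivePiece

/-! ### Lightlike curves with `Λτ = 1`, and the case distinction. -/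

namespace Spacetime

variable {E : Type*} [NormedAddCommGroup E] [NormedSpace ℝ E]
  {M : Type*} [TopologicalSpace M] [ChartedSpace E M] [IsManifold 𝓘(ℝ, E) ∞ M]
  (S : Spacetime E M) {γ ρ : ℝ → ℝ × M} {a b : ℝ}

/-- Velocities are multiplied by a positive number `u'`, and `L` by `u'²`, so future timelike
velocities remain so. -/
theorem HasTimelikeVariation.comp {u : ℝ → ℝ} (hab : a < b)
    (hu : PiecewiseOn (PositivePiece u) a b) (h : S.HasTimelikeVariation γ (u a) (u b))
    (heq : EqOn (γ ∘ u) ρ (Icc a b)) : S.HasTimelikeVariation ρ a b := by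
  obtain ⟨ε, ψ, hψ, h⟩ := h
  have hc := hu.continuousOn_of_positivePiece hab
  have hm := hu.strictMonoOn_of_positivePiece hab
  have ha : a ∈ Icc a b := ⟨le_rfl, hab.le⟩
  have hb : b ∈ Icc a b := ⟨hab.le, le_rfl⟩
  have hmaps : ∀ c d, a ≤ c → c < d → d ≤ b → MapsTo u (Icc c d) (Icc (u c) (u d)) :=
    fun c d hc hcd hd => (hm.monotoneOn.mono (Icc_subset_Icc hc hd)).mapsTo_Icc
  refine ⟨ε, fun w s => ψ w (u s), IsProperVariation.of_smoothStrip hab hψ.eps_pos ?_ ?_ ?_ ?_,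
    fun w hw hw0 => ?_⟩
  · intro s hs
    rw [hψ.base _ (hmaps a b le_rfl hab le_rfl hs), ← heq hs]
    rfl
  · intro w hw
    rw [hψ.left_end w hw, ← heq ha]
    rfl
  · intro w hw
    rw [hψ.right_end w hw, ← heq hb]
    rfl
  · refine (PiecewiseOn.comp_and_positivePiece (hereditary_smoothStrip ψ ε) hab hu
      hψ.smooth).mono ?_
    rintro c d hac hcd hdb ⟨h2, h3⟩
    exact h2.comp (g := fun z => (z.1, u z.2))
      (contDiffOn_fst.prodMk (h3.1.comp contDiffOn_snd fun z hz => hz.2))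
      fun z hz => ⟨hz.1, hmaps c d hac hcd hdb hz.2⟩
  · refine (PiecewiseOn.comp_and_positivePiece (hereditary_pieceSat _ _) hab hu
      (h w hw hw0)).mono ?_
    rintro c d hac hcd hdb ⟨h2, h3, u', hu'⟩
    refine h2.comp hcd h3 (fun s hs => (hu' s hs).1) (hmaps c d hac hcd hdb) fun s hs v hv => ?_
    have hpos := (hu' s hs).2
    refine ⟨?_, mul_pos hpos hv.2⟩
    rw [S.L_smul _ _ hpos.le]
    exact mul_neg_of_pos_of_neg (by positivity) hv.1

/-- Lightlike and future-pointing. -/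
def FutureLightlike (p : ℝ × M) (v : Tan E p) : Prop := v.2 ≠ 0 ∧ S.L p v = 0 ∧ 0 < v.1

theorem lightlike_and_future_iff (p : ℝ × M) (v : Tan E p) :
    S.Lightlike p v ∧ S.FuturePointing p v ↔ S.FutureLightlike p v := by
  rw [lightlike_iff, futurePointing_iff, FutureLightlike, and_assoc]

theorem futureLightlike_of_futureCausal {p : ℝ × M} {v : Tan E p} (h : S.FutureCausal p v)
    (h' : ¬ S.L p v < 0) : S.FutureLightlike p v := by
  have h0 := h.1.eq_of_not_lt h'
  refine ⟨fun h2 => ?_, h0, h.2⟩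
  have : S.L p v = -(S.lapse p.2 * v.1 ^ 2) := by simp [L, h2, F_zero]
  have := mul_pos (S.lapse_pos p.2) (pow_pos h.2 2)
  linarith

/-- A future-pointing lightlike curve has a parameter change after which `Λ dt = 1`. -/
theorem exists_unit_parameter (hab : a < b) (hρ : PiecewiseOn (PieceSat E S.FutureLightlike ρ) a b) :
    ∃ u : ℝ → ℝ, PiecewiseOn (fun c d => PieceSat E S.FutureLightlike ρ c d ∧
      ContDiffOn ℝ ∞ u (Icc c d) ∧ ∀ s ∈ Icc c d, HasDerivWithinAt u
        (S.lapse (ρ s).2 * (velocityWithin E ρ (Icc c d) s).1) (Icc c d) s) a b := by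
  -- The new parameter is the primitive of `Λτ`; right velocities give one integrand across all
  -- breaks.
  set g : ℝ → ℝ := fun s => S.lapse (ρ s).2 * (velocityRight E ρ s).1 with hg
  have h0 : (0 : ℝ) ∈ Ioo (-1 : ℝ) 1 := by norm_num
  have key : ∀ c d, c < d → PieceSat E S.FutureLightlike ρ c d →
      ContDiffOn ℝ ∞ (fun s => S.lapse (ρ s).2 * (velocityWithin E ρ (Icc c d) s).1) (Icc c d) ∧
      EqOn g (fun s => S.lapse (ρ s).2 * (velocityWithin E ρ (Icc c d) s).1) (Ico c d) := by
    intro c d hcd h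
    have hs := smoothStrip_const h.1 1
    have hm : MapsTo (fun s : ℝ => ((0, s) : ℝ × ℝ)) (Icc c d) (strip 1 c d) :=
      fun s hs => ⟨h0, hs⟩
    refine ⟨((S.contDiffOn_lapse hs).mul (hs.contDiffOn_velocity_fst hcd)).comp
      (f := fun s : ℝ => ((0, s) : ℝ × ℝ)) (by fun_prop) hm, fun s hs => ?_⟩
    simp only [hg]
    rw [velocityRight_eq h.1 hs]
  have hint : IntervalIntegrable g volume a b := by
    refine hρ.induct (Q := fun c d => IntervalIntegrable g volume c d) hab ?_ ?_
    · intro c d _ hcd _ h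
      exact (contDiffOn_integral_piece hcd .refl (key c d hcd h).1 (key c d hcd h).2).1
    · exact fun c d _ _ _ h1 h2 => h1.trans h2
  refine ⟨fun s => ∫ x in a..s, g x, hρ.mono fun c d hac hcd hdb h => ?_⟩
  refine ⟨h, (contDiffOn_integral_piece hcd (hint.mono_set ?_) (key c d hcd h).1
    (key c d hcd h).2).2⟩
  rw [uIcc_of_le hac, uIcc_of_le hab.le]
  exact Icc_subset_Icc le_rfl (hcd.le.trans hdb)

/-- With `φ` the inverse of the unit parameter `u`, the curve `ρ ∘ φ` satisfies `Λτ = 1` and is no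
geodesic, as `φ` would otherwise exhibit `ρ` as a pregeodesic. The variation found for `ρ ∘ φ` is
pulled back along `u`. -/
theorem hasTimelikeVariation_of_not_isPregeodesic (hab : a < b)
    (hρ : PiecewiseOn (PieceSat E S.FutureLightlike ρ) a b) (hn : ¬ S.IsPregeodesic ρ a b) :
    S.HasTimelikeVariation ρ a b := by
  obtain ⟨u, hu⟩ := S.exists_unit_parameter hab hρ
  have hpos : PiecewiseOn (PositivePiece u) a b :=
    hu.mono fun c d _ _ _ h => ⟨h.2.1, _, fun s hs =>
      ⟨h.2.2 s hs, mul_pos (S.lapse_pos _) (h.1.2 s hs).2.2⟩⟩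
  have hc := hpos.continuousOn_of_positivePiece hab
  have hm := hpos.strictMonoOn_of_positivePiece hab
  have ha : a ∈ Icc a b := ⟨le_rfl, hab.le⟩
  have hb : b ∈ Icc a b := ⟨hab.le, le_rfl⟩
  have huab : u a < u b := hm ha hb hab
  have hsurj : SurjOn u (Icc a b) (Icc (u a) (u b)) := intermediate_value_Icc hab.le hc
  set φ := Function.invFunOn u (Icc a b) with hφ
  have hφmaps : MapsTo φ (Icc (u a) (u b)) (Icc a b) := hsurj.mapsTo_invFunOn
  have hr : ∀ y ∈ Icc (u a) (u b), u (φ y) = y := hsurj.rightInvOn_invFunOn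
  have hl : ∀ s ∈ Icc a b, φ (u s) = s := hm.injOn.leftInvOn_invFunOn
  have hφc : ContinuousOn φ (Icc (u a) (u b)) := continuousOn_inverse hm hφmaps hr
  have hφm : StrictMonoOn φ (Icc (u a) (u b)) := by
    intro x hx y hy hxy
    rw [← hm.lt_iff_lt (hφmaps hx) (hφmaps hy), hr x hx, hr y hy]
    exact hxy
  -- Writes the endpoints as `φ (u a)` and `φ (u b)`, so that the subdivision can be pulled back
  -- along `φ`.
  rw [← hl a ha, ← hl b hb] at hu
  have hpieces := (PiecewiseOn.comp huab.le hφc hφm hu).mono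
    (Q := fun x y => PositivePiece φ x y ∧ PieceSat E S.UnitLightlike (ρ ∘ φ) x y) <| by
    rintro x y hax hxy hyb ⟨hp, huc, hud⟩
    have hx : x ∈ Icc (u a) (u b) := ⟨hax, hxy.le.trans hyb⟩
    have hy : y ∈ Icc (u a) (u b) := ⟨hax.trans hxy.le, hyb⟩
    have hφxy : φ x < φ y := hφm hx hy hxy
    have hsub := Icc_subset_Icc hax hyb
    have hmaps : MapsTo φ (Icc x y) (Icc (φ x) (φ y)) :=
      (hφm.monotoneOn.mono hsub).mapsTo_Icc
    have huD := uniqueDiffOn_Icc hφxy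
    have hτ : ∀ s ∈ Icc (φ x) (φ y),
        0 < S.lapse (ρ s).2 * (velocityWithin E ρ (Icc (φ x) (φ y)) s).1 := fun s hs =>
      mul_pos (S.lapse_pos _) (hp.2 s hs).2.2
    obtain ⟨h1, h2⟩ := contDiffOn_inverse (φ := φ) hφxy huc
      (fun s hs => by rw [(hud s hs).derivWithin (huD s hs)]; exact hτ s hs)
      (by rwa [hr x hx, hr y hy]) (fun t ht => by
        rw [hr x hx, hr y hy] at ht
        exact hr t (hsub ht))
    rw [hr x hx, hr y hy] at h1 h2
    have h3 : ∀ t ∈ Icc x y, HasDerivWithinAt φ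
        (S.lapse (ρ (φ t)).2 * (velocityWithin E ρ (Icc (φ x) (φ y)) (φ t)).1)⁻¹ (Icc x y) t := by
      intro t ht
      rw [← (hud _ (hmaps ht)).derivWithin (huD _ (hmaps ht))]
      exact h2 t ht
    refine ⟨⟨h1, _, fun t ht => ⟨h3 t ht, inv_pos.2 (hτ _ (hmaps ht))⟩⟩,
      hp.1.comp h1.contMDiffOn hmaps, fun t ht => ?_⟩
    have hpos := hτ _ (hmaps ht)
    obtain ⟨h4, h5, -⟩ := hp.2 _ (hmaps ht)
    rw [velocityWithin_comp hp.1 (h3 t ht) hmaps ht (uniqueDiffOn_Icc hxy t ht)]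
    refine ⟨smul_ne_zero (inv_pos.2 hpos).ne' h4, ?_, ?_⟩
    · exact (S.L_smul _ _ (inv_pos.2 hpos).le).trans (mul_eq_zero_of_right _ h5)
    · simp only [Function.comp_apply, Prod.smul_fst, smul_eq_mul]
      rw [mul_left_comm]
      exact inv_mul_cancel₀ hpos.ne'
  have hγ : PiecewiseOn (PieceSat E S.UnitLightlike (ρ ∘ φ)) (u a) (u b) :=
    hpieces.mono fun _ _ _ _ _ h => h.2
  have hcurve : IsCurve E (ρ ∘ φ) (u a) (u b) :=
    (isCurve_iff huab).2 (hγ.mono fun _ _ _ _ _ h => h.1)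
  have hreg : PiecewiseOn (fun x y => ContDiffOn ℝ 1 φ (Icc x y) ∧
      ∀ s ∈ Icc x y, 0 < derivWithin φ (Icc x y) s) (u a) (u b) :=
    hpieces.mono fun x y _ hxy _ h =>
      ⟨h.1.1.of_le (by exact_mod_cast le_top), h.1.derivWithin_pos hxy⟩
  have hrep : IsReparametrization φ (u a) (u b) a b := ⟨hφc, hl a ha, hl b hb, hreg⟩
  have hcrit : ¬ S.IsGeodesic (ρ ∘ φ) (u a) (u b) := fun h => hn ⟨u a, u b, φ, huab, hrep, h⟩
  rw [IsGeodesic, not_and] at hcrit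
  have hcrit' := hcrit hcurve
  push Not at hcrit'
  obtain ⟨ε, ψ, hψ, hψn⟩ := hcrit'
  exact (S.hasTimelikeVariation_of_not_critical huab hψ hγ hψn).comp S hab hpos
    fun s hs => congrArg ρ (hl s hs)

/-- A single velocity with `L < 0` spreads to an interval; if there is none, `L = 0` throughout, and
`τ > 0` then forces nonzero spatial velocity. -/
theorem exists_timelike_piece (hρ : PiecewiseOn (PieceSat E S.FutureCausal ρ) a b)
    (hn : ¬ PiecewiseOn (PieceSat E S.FutureLightlike ρ) a b) :
    ∃ c d, a ≤ c ∧ c < d ∧ d ≤ b ∧ PieceSat E S.FutureTimelike ρ c d := by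
  by_contra hcon
  refine hn (hρ.mono fun c d hac hcd hdb h => ⟨h.1, fun s hs => ?_⟩)
  refine S.futureLightlike_of_futureCausal (h.2 s hs) fun hneg => hcon ?_
  obtain ⟨c', d', h1, h2, h3, h4⟩ := S.exists_pieceSat_timelike hcd h hs hneg
  exact ⟨c', d', hac.trans h1, h2, h3.trans hdb, h4⟩

theorem hasTimelikeVariation_of_not_isLightlikePregeodesic (hab : a < b)
    (hc : S.IsCausalCurve ρ a b) (hf : S.IsFuturePointing ρ a b)
    (hn : ¬ S.IsLightlikePregeodesic ρ a b) : S.HasTimelikeVariation ρ a b := by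
  have hρ := (S.isCausalCurve_and_isFuturePointing_iff hab).1 ⟨hc, hf⟩
  by_cases hl : PiecewiseOn (PieceSat E S.FutureLightlike ρ) a b
  · refine S.hasTimelikeVariation_of_not_isPregeodesic hab hl fun hp => hn ⟨?_, hp⟩
    have := (isCurve_and_velocitiesSatisfy_iff hab).2 (hl.mono fun _ _ _ _ _ h =>
      h.imp (Q := S.Lightlike) fun p v hv => ((S.lightlike_and_future_iff p v).2 hv).1)
    exact this
  · obtain ⟨c, d, h1, h2, h3, h4⟩ := S.exists_timelike_piece hρ hl
    exact S.hasTimelikeVariation_of_timelike_piece h1 h2 h3 hρ h4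

end Spacetime

end StaticFinsler

theorem mainTheorem6 {E : Type*} [NormedAddCommGroup E] [NormedSpace ℝ E] [FiniteDimensional ℝ E]
    {M : Type*} [TopologicalSpace M] [T2Space M] [ParacompactSpace M] [ConnectedSpace M]
    [ChartedSpace E M] [IsManifold 𝓘(ℝ, E) ∞ M] (S : Spacetime E M) :
    (∀ (a b : ℝ) (ρ : ℝ → ℝ × M), a < b → S.IsCausalCurve ρ a b → S.IsFuturePointing ρ a b →
      ¬ S.IsLightlikePregeodesic ρ a b →
      ∃ (ε : ℝ) (ψ : ℝ → ℝ → ℝ × M), IsProperVariation E ρ a b ε ψ ∧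
        ∀ w ∈ Ioo (-ε) ε, w ≠ 0 →
          S.IsTimelikeCurve (ψ w) a b ∧ S.IsFuturePointing (ψ w) a b) ∧
    (∀ p q z : ℝ × M, S.CausalRel p q → S.Chron q z → S.Chron p z) ∧
    (∀ p q z : ℝ × M, S.Chron p q → S.CausalRel q z → S.Chron p z) ∧
    (∀ p : ℝ × M, closure (S.causalFuture p) = closure (S.chronFuture p)) ∧
    (∀ p : ℝ × M, closure (S.causalPast p) = closure (S.chronPast p)) := by
  refine ⟨fun a b ρ hab hc hf hn => ?_, fun p q z => S.chron_of_causalRel_of_chron,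
    fun p q z => S.chron_of_chron_of_causalRel, S.closure_causalFuture, S.closure_causalPast⟩
  obtain ⟨ε, ψ, hψ, h⟩ := S.hasTimelikeVariation_of_not_isLightlikePregeodesic hab hc hf hn
  exact ⟨ε, ψ, hψ, fun w hw hw0 =>
    (S.isTimelikeCurve_and_isFuturePointing_iff hab).2 (h w hw hw0)⟩
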